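/- All algebras are unital algebras over $\mathbb{C}$ and $\otimes=\otimes_{\mathbb C}$. Let $A$ be a Hopf algebra with bijective antipode, coproduct $\Delta(a)=a_{(1)}\otimes a_{(2)}$ and counit $\varepsilon$. A left coideal subalgebra $B\subseteq A$ (a unital subalgebra with $\Delta(B)\subseteq A\otimes B$) is called a quantum homogeneous $A$-space if $A$ is faithfully flat as a right $B$-module (that is, the functor $A\otimes_B-$ from left $B$-modules to vector spaces preserves and reflects exact sequences) and $B^+A=AB^+$, where $B^+=B\cap\ker\varepsilon$. Write $\pi_B:A\to\pi_B(A):=A/B^+A$ for the canonical projection onto the quotient coalgebra. Let $B\subseteq P\subseteq A$ be a nested pair of quantum homogeneous $A$-spaces. Let $\pi_B(P)\subseteq\pi_B(A)$ be the image of $P$, with the left $\pi_P(A)$-coaction $\pi_B(p)\mapsto\pi_P(p_{(1)})\otimes\pi_B(p_{(2)})$, and let $A\,\square_{\pi_P}\,\pi_B(P)\subseteq A\otimes\pi_B(P)$ be the cotensor product over $\pi_P(A)$, where $A$ has the right coaction $(\mathrm{id}\otimes\pi_P)\circ\Delta$. An $(A,P)$-relative Hopf module is a left $P$-module $\mathcal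 F$ with a left $A$-comodule structure $\Delta_L:\mathcal F\to A\otimes\mathcal F$ such that $\Delta_L(pf)=\Delta(p)\Delta_L(f)$ for all $p\in P$, $f\in\mathcal F$; morphisms are the left $P$-module, left $A$-comodule maps. Regard $P\otimes_BP$ as such a module with $P$ acting on the first factor and with the diagonal coaction $p\otimes q\mapsto p_{(1)}q_{(1)}\otimes(p_{(2)}\otimes q_{(2)})$, and $A\,\square_{\pi_P}\,\pi_B(P)$ with $P$-action and $A$-coaction $\Delta\otimes\mathrm{id}$ both defined on the first factor. Then the canonical map $$\mathrm{can}:A\otimes_BA\to A\otimes\pi_B(A),\qquad a\otimes a'\mapsto a\,a'_{(1)}\otimes\pi_B(a'_{(2)}),$$ restricts to an isomorphism of $(A,P)$-relative Hopf modules $$P\otimes_BP\;\xrightarrow{\ \simeq\ }\;A\,\square_{\pi_P}\,\pi_B(P).$$ Explicitly, the natural map $P\otimes_BP\to A\otimes_BA$ is injective, and its composition with $\mathrm{can}$ takes values in $A\,\square_{\pi_P}\,\pi_B(P)\subseteq A\otimes\pi_B(A)$ and is an isomorphism of $(A,P)$-relative Hopf modules onto it. -/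

import Mathlib

open scoped TensorProduct

universe u

noncomputable section

namespace QHS

/-! ### Linear algebra -/

section Linear

variable {k : Type*} [Field k]
variable {V W W' X : Type*} [AddCommGroup V] [Module k V] [AddCommGroup W] [Module k W]
  [AddCommGroup W'] [Module k W'] [AddCommGroup X] [Module k X]

theorem lTensor_injective (i : W' →ₗ[k] W) (hi : Function.Injective i) :
    Function.Injective (i.lTensor X) :=
  Module.Flat.lTensor_preserves_injective_linearMap i hi

/-- A linear map `f : V → X ⊗ W` with values in the image of `X ⊗ W'`, regarded as a map into
`X ⊗ W'`, for an injective linear map `i : W' → W`. -/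
def corestrict (i : W' →ₗ[k] W) (hi : Function.Injective i) (f : V →ₗ[k] X ⊗[k] W)
    (hf : ∀ v, f v ∈ LinearMap.range (i.lTensor X)) : V →ₗ[k] X ⊗[k] W' :=
  (LinearEquiv.ofInjective (i.lTensor X) (lTensor_injective i hi)).symm.toLinearMap ∘ₗ
    f.codRestrict _ hf

theorem lTensor_corestrict (i : W' →ₗ[k] W) (hi : Function.Injective i) (f : V →ₗ[k] X ⊗[k] W)
    (hf : ∀ v, f v ∈ LinearMap.range (i.lTensor X)) (v : V) :
    i.lTensor X (corestrict i hi f hf v) = f v := by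
  have := congrArg Subtype.val ((LinearEquiv.ofInjective (i.lTensor X)
    (lTensor_injective i hi)).apply_symm_apply (f.codRestrict _ hf v))
  exact this

theorem mem_range_lTensor (i : W' →ₗ[k] W) (d : W →ₗ[k] V) (h : Function.Exact i d)
    (t : X ⊗[k] W) (ht : d.lTensor X t = 0) : t ∈ LinearMap.range (i.lTensor X) :=
  (Module.Flat.lTensor_exact X h t).1 ht

end Linear

section Diagonal

variable {k : Type*} [Field k] {A : Type*} [Ring A] [Algebra k A]
variable {V W T V' W' T' : Type*} [AddCommGroup V] [Module k V] [AddCommGroup W] [Module k W]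
  [AddCommGroup T] [Module k T] [AddCommGroup V'] [Module k V'] [AddCommGroup W'] [Module k W']
  [AddCommGroup T'] [Module k T']

/-- For a bilinear map `g`, the bilinear map `(a ⊗ v, a' ⊗ w) ↦ a a' ⊗ g(v, w)`. -/
def diag (A : Type*) [Ring A] [Algebra k A] (g : V →ₗ[k] W →ₗ[k] T) :
    A ⊗[k] V →ₗ[k] A ⊗[k] W →ₗ[k] A ⊗[k] T :=
  TensorProduct.map₂ (LinearMap.mul k A) g

theorem diag_tmul (g : V →ₗ[k] W →ₗ[k] T) (a b : A) (v : V) (w : W) :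
    diag A g (a ⊗ₜ[k] v) (b ⊗ₜ[k] w) = (a * b) ⊗ₜ[k] g v w := by
  simp [diag]

theorem lTensor_diag (g : V →ₗ[k] W →ₗ[k] T) (g' : V' →ₗ[k] W' →ₗ[k] T') (α : V →ₗ[k] V')
    (β : W →ₗ[k] W') (φ : T →ₗ[k] T') (h : ∀ v w, φ (g v w) = g' (α v) (β w))
    (x : A ⊗[k] V) (y : A ⊗[k] W) :
    φ.lTensor A (diag A g x y) = diag A g' (α.lTensor A x) (β.lTensor A y) := by
  induction x with
  | zero => simp only [map_zero, LinearMap.zero_apply]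
  | add x y h1 h2 => simp only [map_add, LinearMap.add_apply, h1, h2]
  | tmul a p =>
    induction y with
    | zero => simp only [map_zero]
    | add x y h1 h2 => simp only [map_add, h1, h2]
    | tmul b q => simp only [diag_tmul, LinearMap.lTensor_tmul, h]

theorem diag_assoc {V₁ V₂ V₃ V₁₂ V₂₃ : Type*} [AddCommGroup V₁] [Module k V₁]
    [AddCommGroup V₂] [Module k V₂] [AddCommGroup V₃] [Module k V₃] [AddCommGroup V₁₂]
    [Module k V₁₂] [AddCommGroup V₂₃] [Module k V₂₃] (f : V₁ →ₗ[k] V₂ →ₗ[k] V₁₂)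
    (f' : V₁₂ →ₗ[k] V₃ →ₗ[k] T) (g : V₂ →ₗ[k] V₃ →ₗ[k] V₂₃) (g' : V₁ →ₗ[k] V₂₃ →ₗ[k] T)
    (h : ∀ u v w, f' (f u v) w = g' u (g v w)) (x : A ⊗[k] V₁) (y : A ⊗[k] V₂)
    (z : A ⊗[k] V₃) : diag A f' (diag A f x y) z = diag A g' x (diag A g y z) := by
  induction x with
  | zero => simp only [map_zero, LinearMap.zero_apply]
  | add x y h1 h2 => simp only [map_add, LinearMap.add_apply, h1, h2]
  | tmul a p =>
    induction y with
    | zero => simp only [map_zero, LinearMap.zero_apply]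
    | add x y h1 h2 => simp only [map_add, LinearMap.add_apply, h1, h2]
    | tmul b q =>
      induction z with
      | zero => simp only [map_zero]
      | add x y h1 h2 => simp only [map_add, h1, h2]
      | tmul c r => simp only [diag_tmul, mul_assoc, h]

theorem diag_mul {R : Type*} [Ring R] [Algebra k R] (x y : A ⊗[k] R) :
    diag A (LinearMap.mul k R) x y = x * y := by
  induction x with
  | zero => simp only [map_zero, LinearMap.zero_apply, zero_mul]
  | add x y h1 h2 => simp only [map_add, LinearMap.add_apply, add_mul, h1, h2]
  | tmul a p =>
    induction y with
    | zero => simp only [map_zero, mul_zero]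
    | add x y h1 h2 => simp only [map_add, mul_add, h1, h2]
    | tmul b q =>
      rw [diag_tmul, Algebra.TensorProduct.tmul_mul_tmul, LinearMap.mul_apply']

end Diagonal

section DiagonalBialgebra

variable {k : Type*} [Field k] {A : Type*} [Ring A] [Bialgebra k A]
variable {V W T : Type*} [AddCommGroup V] [Module k V] [AddCommGroup W] [Module k W]
  [AddCommGroup T] [Module k T]

theorem assoc_comul_diag (g : V →ₗ[k] W →ₗ[k] T) (x : A ⊗[k] V) (y : A ⊗[k] W) :
    TensorProduct.assoc k A A T (Coalgebra.comul.rTensor T (diag A g x y)) =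
      diag A (diag A g) (TensorProduct.assoc k A A V (Coalgebra.comul.rTensor V x))
        (TensorProduct.assoc k A A W (Coalgebra.comul.rTensor W y)) := by
  induction x with
  | zero => simp only [map_zero, LinearMap.zero_apply]
  | add x y h1 h2 => simp only [map_add, LinearMap.add_apply, h1, h2]
  | tmul a p =>
    induction y with
    | zero => simp only [map_zero]
    | add x y h1 h2 => simp only [map_add, h1, h2]
    | tmul b q =>
      rw [diag_tmul, LinearMap.rTensor_tmul, LinearMap.rTensor_tmul, LinearMap.rTensor_tmul,
        Bialgebra.comul_mul]
      generalize (Coalgebra.comul a : A ⊗[k] A) = c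
      generalize (Coalgebra.comul b : A ⊗[k] A) = d
      induction c with
      | zero => simp only [map_zero, LinearMap.zero_apply, zero_mul, TensorProduct.zero_tmul]
      | add x y h1 h2 => simp only [map_add, LinearMap.add_apply, add_mul,
          TensorProduct.add_tmul, h1, h2]
      | tmul a a' =>
        induction d with
        | zero => simp only [map_zero, mul_zero, TensorProduct.zero_tmul]
        | add x y h1 h2 => simp only [map_add, mul_add, TensorProduct.add_tmul, h1, h2]
        | tmul b b' =>
          rw [Algebra.TensorProduct.tmul_mul_tmul, TensorProduct.assoc_tmul,
            TensorProduct.assoc_tmul, TensorProduct.assoc_tmul, diag_tmul, diag_tmul]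

theorem counit_diag (g : V →ₗ[k] W →ₗ[k] T) (x : A ⊗[k] V) (y : A ⊗[k] W) :
    TensorProduct.lid k T (Coalgebra.counit.rTensor T (diag A g x y)) =
      g (TensorProduct.lid k V (Coalgebra.counit.rTensor V x))
        (TensorProduct.lid k W (Coalgebra.counit.rTensor W y)) := by
  induction x with
  | zero => simp only [map_zero, LinearMap.zero_apply]
  | add x y h1 h2 => simp only [map_add, LinearMap.add_apply, h1, h2]
  | tmul a p =>
    induction y with
    | zero => simp only [map_zero]
    | add x y h1 h2 => simp only [map_add, h1, h2]
    | tmul b q => simp [diag_tmul, mul_smul, smul_comm (Coalgebra.counit (R := k) a)]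

end DiagonalBialgebra

/-! ### Tensor products over a noncommutative subalgebra, and faithful flatness -/

section TensorOver

variable {k : Type*} [Field k] {R : Type*} [Ring R] [Algebra k R]

/-- The relations `r s ⊗ n = r ⊗ s n` (`r ∈ R`, `s ∈ S`, `n ∈ N`) that define `R ⊗_S N`. -/
def tensorRel (S : Subalgebra k R) (N : Type*) [AddCommGroup N] [Module k N] [Module S N] :
    Submodule R (R ⊗[k] N) :=
  Submodule.span R {t | ∃ (r : R) (s : S) (n : N), t = (r * s) ⊗ₜ[k] n - r ⊗ₜ[k] (s • n)}

/-- The tensor product `R ⊗_S N` of the right `S`-module `R` with the left `S`-module `N`, for a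
subalgebra `S` of `R`; it is a left `R`-module by multiplication on the first factor. -/
def TensorOver (S : Subalgebra k R) (N : Type*) [AddCommGroup N] [Module k N] [Module S N] :
    Type _ :=
  (R ⊗[k] N) ⧸ tensorRel S N

section

variable (S : Subalgebra k R) (N : Type*) [AddCommGroup N] [Module k N] [Module S N]

instance : AddCommGroup (TensorOver S N) :=
  inferInstanceAs (AddCommGroup ((R ⊗[k] N) ⧸ tensorRel S N))

instance : Module R (TensorOver S N) :=
  inferInstanceAs (Module R ((R ⊗[k] N) ⧸ tensorRel S N))

instance : Module k (TensorOver S N) :=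
  inferInstanceAs (Module k ((R ⊗[k] N) ⧸ tensorRel S N))

instance : IsScalarTower k R (TensorOver S N) :=
  inferInstanceAs (IsScalarTower k R ((R ⊗[k] N) ⧸ tensorRel S N))

/-- The projection `R ⊗ N → R ⊗_S N`. -/
def TensorOver.mkQ : R ⊗[k] N →ₗ[R] TensorOver S N := (tensorRel S N).mkQ

theorem TensorOver.mkQ_surjective : Function.Surjective (TensorOver.mkQ S N) :=
  (tensorRel S N).mkQ_surjective

theorem TensorOver.mkQ_eq_zero (x : R ⊗[k] N) :
    TensorOver.mkQ S N x = 0 ↔ x ∈ tensorRel S N :=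
  Submodule.Quotient.mk_eq_zero _

end

/-- The class of `r ⊗ n` in `R ⊗_S N`. -/
def TensorOver.tmul (S : Subalgebra k R) {N : Type*} [AddCommGroup N] [Module k N] [Module S N]
    (r : R) (n : N) : TensorOver S N :=
  TensorOver.mkQ S N (r ⊗ₜ[k] n)

theorem TensorOver.balanced (S : Subalgebra k R) {N : Type*} [AddCommGroup N] [Module k N]
    [Module S N] (r : R) (s : S) (n : N) :
    TensorOver.tmul S (r * s) n = TensorOver.tmul S r (s • n) := by
  rw [← sub_eq_zero, TensorOver.tmul, TensorOver.tmul, ← map_sub, TensorOver.mkQ_eq_zero]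
  exact Submodule.subset_span ⟨r, s, n, rfl⟩

/-- The map `id ⊗ f : R ⊗_S N → R ⊗_S N'` induced by a map `f : N → N'` of left `S`-modules. -/
def TensorOver.map (S : Subalgebra k R) {N N' : Type*}
    [AddCommGroup N] [Module k N] [Module S N] [IsScalarTower k S N]
    [AddCommGroup N'] [Module k N'] [Module S N'] [IsScalarTower k S N']
    (f : N →ₗ[S] N') : TensorOver S N →ₗ[R] TensorOver S N' :=
  Submodule.mapQ (tensorRel S N) (tensorRel S N')
    (TensorProduct.AlgebraTensorModule.map LinearMap.id (f.restrictScalars k)) (by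
      rw [tensorRel, Submodule.span_le]
      rintro _ ⟨r, s, n, rfl⟩
      refine Submodule.subset_span ⟨r, s, f n, ?_⟩
      simp)

/-- The bilinear map `(r, n) ↦ r ⊗ n`. -/
def TensorOver.mk (S : Subalgebra k R) (N : Type*) [AddCommGroup N] [Module k N] [Module S N] :
    R →ₗ[k] N →ₗ[k] TensorOver S N :=
  (TensorProduct.mk k R N).compr₂ ((TensorOver.mkQ S N).restrictScalars k)

/-- The linear map `R ⊗_S N → X`, `r ⊗ n ↦ f r n`, induced by a bilinear map `f` that satisfies
`f (r s) n = f r (s n)`. -/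
def TensorOver.lift (S : Subalgebra k R) {N X : Type*} [AddCommGroup N] [Module k N] [Module S N]
    [AddCommGroup X] [Module k X] (f : R →ₗ[k] N →ₗ[k] X)
    (hf : ∀ (r : R) (s : S) (n : N), f (r * s) n = f r (s • n)) : TensorOver S N →ₗ[k] X :=
  ((tensorRel S N).restrictScalars k).liftQ (TensorProduct.lift f) (by
      intro x hx
      have h : ∀ r : R, TensorProduct.lift f (r • x) = 0 := by
        replace hx : x ∈ tensorRel S N := hx
        rw [tensorRel] at hx
        induction hx using Submodule.span_induction with
        | mem x hx =>
          obtain ⟨r, s, n, rfl⟩ := hx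
          intro r'
          rw [smul_sub, TensorProduct.smul_tmul', TensorProduct.smul_tmul', map_sub,
            TensorProduct.lift.tmul, TensorProduct.lift.tmul, smul_eq_mul, smul_eq_mul,
            ← mul_assoc, hf, sub_self]
        | zero => simp
        | add x y hx hy h1 h2 =>
          intro r
          rw [smul_add, map_add, h1, h2, add_zero]
        | smul a x hx h =>
          intro r
          rw [smul_smul]
          exact h _
      simpa using h 1) ∘ₗ
    (Submodule.Quotient.restrictScalarsEquiv k (tensorRel S N)).symm.toLinearMap

theorem TensorOver.lift_tmul (S : Subalgebra k R) {N X : Type*} [AddCommGroup N] [Module k N]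
    [Module S N] [AddCommGroup X] [Module k X] (f : R →ₗ[k] N →ₗ[k] X)
    (hf : ∀ (r : R) (s : S) (n : N), f (r * s) n = f r (s • n)) (r : R) (n : N) :
    TensorOver.lift S f hf (TensorOver.tmul S r n) = f r n := rfl

theorem TensorOver.smul_tmul (S : Subalgebra k R) {N : Type*} [AddCommGroup N] [Module k N]
    [Module S N] (r r' : R) (n : N) :
    r • TensorOver.tmul S r' n = TensorOver.tmul S (r * r') n := rfl

theorem TensorOver.induction_on (S : Subalgebra k R) {N : Type*} [AddCommGroup N] [Module k N]
    [Module S N] {p : TensorOver S N → Prop} (x : TensorOver S N) (zero : p 0)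
    (tmul : ∀ r n, p (TensorOver.tmul S r n)) (add : ∀ x y, p x → p y → p (x + y)) : p x := by
  obtain ⟨y, rfl⟩ := TensorOver.mkQ_surjective S N x
  induction y with
  | zero => simpa using zero
  | add x y h1 h2 => rw [map_add]; exact add _ _ h1 h2
  | tmul r n => exact tmul r n

/-- `R` is faithfully flat as a right module over its subalgebra `S`: the functor `R ⊗_S -` from
left `S`-modules to vector spaces preserves and reflects exact sequences. -/
def RightFaithfullyFlat {k : Type*} [Field k] {R : Type u} [Ring R] [Algebra k R]
    (S : Subalgebra k R) : Prop :=
  ∀ (N₁ N₂ N₃ : Type u)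
    [AddCommGroup N₁] [Module k N₁] [Module S N₁] [IsScalarTower k S N₁]
    [AddCommGroup N₂] [Module k N₂] [Module S N₂] [IsScalarTower k S N₂]
    [AddCommGroup N₃] [Module k N₃] [Module S N₃] [IsScalarTower k S N₃]
    (f : N₁ →ₗ[S] N₂) (g : N₂ →ₗ[S] N₃),
    Function.Exact f g ↔ Function.Exact (TensorOver.map S f) (TensorOver.map S g)

end TensorOver

/-! ### Comodules and cotensor products -/

section Comodules

variable (k : Type*) [Field k] (C : Type*) [AddCommGroup C] [Module k C] [Coalgebra k C]

/-- A left `C`-comodule structure on the vector space `V`. -/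
structure LeftComodule (V : Type*) [AddCommGroup V] [Module k V] where
  /-- the coaction -/
  coact : V →ₗ[k] C ⊗[k] V
  coassoc : ∀ v, TensorProduct.assoc k C C V (Coalgebra.comul.rTensor V (coact v)) =
    coact.lTensor C (coact v)
  counit_coact : ∀ v, TensorProduct.lid k V (Coalgebra.counit.rTensor V (coact v)) = v

/-- A right `C`-comodule structure on the vector space `V`. -/
structure RightComodule (V : Type*) [AddCommGroup V] [Module k V] where
  /-- the coaction -/
  coact : V →ₗ[k] V ⊗[k] C
  coassoc : ∀ v, TensorProduct.assoc k V C C (coact.rTensor C (coact v)) =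
    Coalgebra.comul.lTensor V (coact v)
  counit_coact : ∀ v, TensorProduct.rid k V (Coalgebra.counit.lTensor V (coact v)) = v

variable {k C}

/-- The regular left comodule: `C` coacts on itself by its coproduct. -/
def LeftComodule.regular : LeftComodule k C C where
  coact := Coalgebra.comul
  coassoc := Coalgebra.coassoc_apply
  counit_coact := by simp

/-- The left `C`-comodule `C ⊗ V`, with the coaction `Δ ⊗ id`. -/
def LeftComodule.free (V : Type*) [AddCommGroup V] [Module k V] : LeftComodule k C (C ⊗[k] V) where
  coact := (TensorProduct.assoc k C C V).toLinearMap ∘ₗ Coalgebra.comul.rTensor V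
  coassoc x := by
    induction x with
    | zero => simp only [map_zero]
    | add x y h1 h2 => simp only [map_add, h1, h2]
    | tmul c v =>
      have n1 : ∀ y : C ⊗[k] C, TensorProduct.assoc k C C (C ⊗[k] V)
          (Coalgebra.comul.rTensor (C ⊗[k] V) (TensorProduct.assoc k C C V (y ⊗ₜ[k] v))) =
          (((TensorProduct.mk k C V).flip v).lTensor C).lTensor C
            (TensorProduct.assoc k C C C (Coalgebra.comul.rTensor C y)) := by
        intro y
        induction y with
        | zero => simp
        | add x y h1 h2 => simp only [map_add, TensorProduct.add_tmul, h1, h2]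
        | tmul c d =>
          simp only [TensorProduct.assoc_tmul, LinearMap.rTensor_tmul]
          generalize (Coalgebra.comul c : C ⊗[k] C) = z
          induction z with
          | zero => simp
          | add x y h1 h2 => simp only [map_add, TensorProduct.add_tmul, h1, h2]
          | tmul c d => simp
      have n2 : ∀ y : C ⊗[k] C, ((TensorProduct.assoc k C C V).toLinearMap ∘ₗ
          Coalgebra.comul.rTensor V).lTensor C (TensorProduct.assoc k C C V (y ⊗ₜ[k] v)) =
          (((TensorProduct.mk k C V).flip v).lTensor C).lTensor C
            (Coalgebra.comul.lTensor C y) := by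
        intro y
        induction y with
        | zero => simp
        | add x y h1 h2 => simp only [map_add, TensorProduct.add_tmul, h1, h2]
        | tmul c d =>
          simp only [TensorProduct.assoc_tmul, LinearMap.lTensor_tmul, LinearMap.comp_apply,
            LinearMap.rTensor_tmul]
          generalize (Coalgebra.comul d : C ⊗[k] C) = z
          induction z with
          | zero => simp
          | add x y h1 h2 => simp only [map_add, TensorProduct.add_tmul, TensorProduct.tmul_add,
              h1, h2]
          | tmul c d => simp
      simp only [LinearMap.comp_apply, LinearMap.rTensor_tmul, LinearEquiv.coe_coe] at n2 ⊢
      rw [n1, n2, Coalgebra.coassoc_apply]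
  counit_coact x := by
    induction x with
    | zero => simp only [map_zero]
    | add x y h1 h2 => simp only [map_add, h1, h2]
    | tmul c v =>
      have n1 : ∀ y : C ⊗[k] C, TensorProduct.lid k (C ⊗[k] V)
          (Coalgebra.counit.rTensor (C ⊗[k] V) (TensorProduct.assoc k C C V (y ⊗ₜ[k] v))) =
          TensorProduct.lid k C (Coalgebra.counit.rTensor C y) ⊗ₜ[k] v := by
        intro y
        induction y with
        | zero => simp
        | add x y h1 h2 => simp only [map_add, TensorProduct.add_tmul, h1, h2]
        | tmul c d => simp [TensorProduct.smul_tmul']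
      simp only [LinearMap.comp_apply, LinearMap.rTensor_tmul, LinearEquiv.coe_coe]
      rw [n1]
      simp

/-- Restriction of a left coaction to a subspace `i : W → V` with `ρ(W) ⊆ C ⊗ W`. -/
def LeftComodule.restrict {V W : Type*} [AddCommGroup V] [Module k V] [AddCommGroup W] [Module k W]
    (ρ : LeftComodule k C V) (i : W →ₗ[k] V) (hi : Function.Injective i)
    (h : ∀ w, ρ.coact (i w) ∈ LinearMap.range (i.lTensor C)) : LeftComodule k C W where
  coact := corestrict i hi (ρ.coact ∘ₗ i) h
  coassoc w := by
    have e : ∀ w, i.lTensor C (corestrict i hi (ρ.coact ∘ₗ i) h w) = ρ.coact (i w) :=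
      lTensor_corestrict i hi (ρ.coact ∘ₗ i) h
    have e' : i.lTensor C ∘ₗ corestrict i hi (ρ.coact ∘ₗ i) h = ρ.coact ∘ₗ i := LinearMap.ext e
    apply lTensor_injective (X := C) (i.lTensor C) (lTensor_injective i hi)
    have n1 : ∀ x : C ⊗[k] W, (i.lTensor C).lTensor C
        (TensorProduct.assoc k C C W (Coalgebra.comul.rTensor W x)) =
        TensorProduct.assoc k C C V (Coalgebra.comul.rTensor V (i.lTensor C x)) := by
      intro x
      induction x with
      | zero => simp
      | add x y h1 h2 => simp only [map_add, h1, h2]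
      | tmul c w =>
        simp only [LinearMap.rTensor_tmul, LinearMap.lTensor_tmul]
        generalize (Coalgebra.comul c : C ⊗[k] C) = y
        induction y with
        | zero => simp
        | add x y h1 h2 => simp only [map_add, TensorProduct.add_tmul, h1, h2]
        | tmul c d => simp
    have n2 : ∀ x : C ⊗[k] W, (i.lTensor C).lTensor C
        ((corestrict i hi (ρ.coact ∘ₗ i) h).lTensor C x) = ρ.coact.lTensor C (i.lTensor C x) := by
      intro x
      rw [← LinearMap.comp_apply, ← LinearMap.lTensor_comp, e', LinearMap.lTensor_comp,
        LinearMap.comp_apply]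
    rw [n1, n2, e, ρ.coassoc]
  counit_coact w := by
    apply hi
    have n1 : ∀ x : C ⊗[k] W, i (TensorProduct.lid k W (Coalgebra.counit.rTensor W x)) =
        TensorProduct.lid k V (Coalgebra.counit.rTensor V (i.lTensor C x)) := by
      intro x
      induction x with
      | zero => simp
      | add x y h1 h2 => simp only [map_add, h1, h2]
      | tmul c w => simp
    rw [n1, lTensor_corestrict]
    exact ρ.counit_coact (i w)

/-- A left `C`-comodule becomes a left `D`-comodule along a coalgebra map `φ : C → D`. -/
def LeftComodule.pushforward {D : Type*} [AddCommGroup D] [Module k D] [Coalgebra k D]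
    {V : Type*} [AddCommGroup V] [Module k V] (ρ : LeftComodule k C V) (φ : C →ₗc[k] D) :
    LeftComodule k D V where
  coact := φ.toLinearMap.rTensor V ∘ₗ ρ.coact
  coassoc v := by
    have n1 : ∀ x : C ⊗[k] V, TensorProduct.assoc k D D V
        (Coalgebra.comul.rTensor V (φ.toLinearMap.rTensor V x)) =
        TensorProduct.map φ.toLinearMap (φ.toLinearMap.rTensor V)
          (TensorProduct.assoc k C C V (Coalgebra.comul.rTensor V x)) := by
      intro x
      induction x with
      | zero => simp
      | add x y h1 h2 => simp only [map_add, h1, h2]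
      | tmul c v =>
        have := LinearMap.congr_fun φ.map_comp_comul c
        simp only [LinearMap.comp_apply] at this
        simp only [LinearMap.rTensor_tmul]
        rw [← this]
        generalize (Coalgebra.comul c : C ⊗[k] C) = y
        induction y with
        | zero => simp
        | add x y h1 h2 => simp only [map_add, TensorProduct.add_tmul, h1, h2]
        | tmul c d => simp
    rw [LinearMap.comp_apply, n1, ρ.coassoc]
    generalize ρ.coact v = x
    induction x with
    | zero => simp
    | add x y h1 h2 => simp only [map_add, h1, h2]
    | tmul c v => simp
  counit_coact v := by
    conv_rhs => rw [← ρ.counit_coact v]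
    rw [LinearMap.comp_apply]
    generalize ρ.coact v = x
    induction x with
    | zero => simp
    | add x y h1 h2 => simp only [map_add, h1, h2]
    | tmul c v =>
      simp

/-- `C` as a right `D`-comodule along a coalgebra map `φ : C → D`: the coaction is
`(id ⊗ φ) ∘ Δ`. -/
def RightComodule.ofCoalgHom {D : Type*} [AddCommGroup D] [Module k D] [Coalgebra k D]
    (φ : C →ₗc[k] D) : RightComodule k D C where
  coact := φ.toLinearMap.lTensor C ∘ₗ Coalgebra.comul
  coassoc c := by
    have n1 : ∀ x : C ⊗[k] C, Coalgebra.comul.lTensor C (φ.toLinearMap.lTensor C x) =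
        (TensorProduct.map φ.toLinearMap φ.toLinearMap).lTensor C
          (Coalgebra.comul.lTensor C x) := by
      intro x
      induction x with
      | zero => simp
      | add x y h1 h2 => simp only [map_add, h1, h2]
      | tmul c d =>
        simp
    rw [LinearMap.comp_apply, n1, ← Coalgebra.coassoc_apply]
    generalize (Coalgebra.comul c : C ⊗[k] C) = x
    induction x with
    | zero => simp
    | add x y h1 h2 => simp only [map_add, h1, h2]
    | tmul c d =>
      simp only [LinearMap.rTensor_tmul, LinearMap.lTensor_tmul, LinearMap.comp_apply]
      generalize (Coalgebra.comul c : C ⊗[k] C) = y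
      induction y with
      | zero => simp
      | add x y h1 h2 => simp only [map_add, TensorProduct.add_tmul, h1, h2]
      | tmul c d => simp
  counit_coact c := by
    have n1 : ∀ x : C ⊗[k] C, Coalgebra.counit.lTensor C (φ.toLinearMap.lTensor C x) =
        Coalgebra.counit.lTensor C x := by
      intro x
      rw [← LinearMap.comp_apply, ← LinearMap.lTensor_comp]
      congr 2
      exact φ.counit_comp
    rw [LinearMap.comp_apply, n1]
    simp

/-- The difference `ρ_M ⊗ id - id ⊗ ρ_V : M ⊗ V → M ⊗ C ⊗ V` of the two coactions. -/
def cotensorDiff {M V : Type*} [AddCommGroup M] [Module k M] [AddCommGroup V] [Module k V]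
    (ρM : RightComodule k C M) (ρV : LeftComodule k C V) :
    M ⊗[k] V →ₗ[k] M ⊗[k] (C ⊗[k] V) :=
  (TensorProduct.assoc k M C V).toLinearMap ∘ₗ ρM.coact.rTensor V - ρV.coact.lTensor M

/-- The cotensor product `M □_C V`, a subspace of `M ⊗ V`. -/
def cotensor {M V : Type*} [AddCommGroup M] [Module k M] [AddCommGroup V] [Module k V]
    (ρM : RightComodule k C M) (ρV : LeftComodule k C V) : Submodule k (M ⊗[k] V) :=
  LinearMap.ker (cotensorDiff ρM ρV)

/-- The comodule `C ⊗ V`, `Δ ⊗ id`, restricts to the cotensor product `C □_D V`. -/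
theorem free_coact_mem {D : Type*} [AddCommGroup D] [Module k D] [Coalgebra k D] (φ : C →ₗc[k] D)
    {V W : Type*} [AddCommGroup V] [Module k V] [AddCommGroup W] [Module k W]
    (ρ : LeftComodule k D V) (i : W →ₗ[k] C ⊗[k] V)
    (hi : Function.Exact i (cotensorDiff (RightComodule.ofCoalgHom φ) ρ)) (w : W) :
    (LeftComodule.free (C := C) V).coact (i w) ∈ LinearMap.range (i.lTensor C) := by
  refine mem_range_lTensor i _ hi _ ?_
  have n1 : ∀ x : C ⊗[k] V, (cotensorDiff (RightComodule.ofCoalgHom φ) ρ).lTensor C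
      ((LeftComodule.free (C := C) V).coact x) =
      (LeftComodule.free (C := C) (D ⊗[k] V)).coact
        (cotensorDiff (RightComodule.ofCoalgHom φ) ρ x) := by
    intro x
    induction x with
    | zero => simp only [map_zero]
    | add x y h1 h2 => simp only [map_add, h1, h2]
    | tmul a v =>
      have e1 : ∀ y : C ⊗[k] C,
          ((TensorProduct.assoc k C (D) V).toLinearMap ∘ₗ
            (RightComodule.ofCoalgHom φ).coact.rTensor V).lTensor C
            (TensorProduct.assoc k C C V (y ⊗ₜ[k] v)) =
          ((((TensorProduct.mk k (D) V).flip v) ∘ₗ φ.toLinearMap).lTensor C).lTensor C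
            (Coalgebra.comul.lTensor C y) := by
        intro y
        induction y with
        | zero => simp
        | add x y h1 h2 => simp only [map_add, TensorProduct.add_tmul, h1, h2]
        | tmul c d =>
          simp only [TensorProduct.assoc_tmul, LinearMap.lTensor_tmul, LinearMap.comp_apply,
            LinearMap.rTensor_tmul, RightComodule.ofCoalgHom, LinearEquiv.coe_coe]
          generalize (Coalgebra.comul d : C ⊗[k] C) = z
          induction z with
          | zero => simp
          | add x y h1 h2 => simp only [map_add, TensorProduct.add_tmul, TensorProduct.tmul_add,
              h1, h2]
          | tmul c d => simp
      have e2 : ∀ y : C ⊗[k] C, (LeftComodule.free (C := C) (D ⊗[k] V)).coact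
          (TensorProduct.assoc k C (D) V (φ.toLinearMap.lTensor C y ⊗ₜ[k] v)) =
          ((((TensorProduct.mk k (D) V).flip v) ∘ₗ φ.toLinearMap).lTensor C).lTensor C
            (TensorProduct.assoc k C C C (Coalgebra.comul.rTensor C y)) := by
        intro y
        induction y with
        | zero => simp
        | add x y h1 h2 => simp only [map_add, TensorProduct.add_tmul, h1, h2]
        | tmul c d =>
          simp only [TensorProduct.assoc_tmul, LinearMap.lTensor_tmul, LinearMap.comp_apply,
            LinearMap.rTensor_tmul, LeftComodule.free, LinearEquiv.coe_coe]
          generalize (Coalgebra.comul c : C ⊗[k] C) = z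
          induction z with
          | zero => simp
          | add x y h1 h2 => simp only [map_add, TensorProduct.add_tmul, h1, h2]
          | tmul c d => simp
      have e3 : ∀ y : C ⊗[k] C, (ρ.coact.lTensor C).lTensor C
          (TensorProduct.assoc k C C V (y ⊗ₜ[k] v)) =
          TensorProduct.assoc k C C (D ⊗[k] V) (y ⊗ₜ[k] ρ.coact v) := by
        intro y
        induction y with
        | zero => simp
        | add x y h1 h2 => simp only [map_add, TensorProduct.add_tmul, h1, h2]
        | tmul c d => simp
      rw [cotensorDiff, LinearMap.lTensor_sub, LinearMap.sub_apply, LinearMap.sub_apply, map_sub]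
      congr 1
      · change _ = (LeftComodule.free (C := C) (D ⊗[k] V)).coact
          (TensorProduct.assoc k C (D) V
            (φ.toLinearMap.lTensor C (Coalgebra.comul a) ⊗ₜ[k] v))
        rw [e2, Coalgebra.coassoc_apply, ← e1]
        rfl
      · exact e3 _
  rw [n1]
  rw [hi.apply_apply_eq_zero, map_zero]

end Comodules

/-! ### Quantum homogeneous spaces -/

section Spaces

variable {k : Type*} [Field k] {A : Type*} [Ring A] [HopfAlgebra k A]

/-- `B` is a left coideal subalgebra of `A`: `Δ(B) ⊆ A ⊗ B`. -/
class IsLeftCoidealSubalgebra (B : Subalgebra k A) : Prop where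
  comul_mem : ∀ b ∈ B, Coalgebra.comul (R := k) b ∈ LinearMap.range (B.val.toLinearMap.lTensor A)

/-- `B⁺ = B ∩ ker ε`. -/
def plus (B : Subalgebra k A) : Submodule k A :=
  Subalgebra.toSubmodule B ⊓ LinearMap.ker (Coalgebra.counit (R := k) (A := A))

/-- The subspace `B⁺A` spanned by the products `b a` with `b ∈ B⁺` and `a ∈ A`. -/
def plusMul (B : Subalgebra k A) : Submodule k A := plus B * ⊤

/-- The quotient `π_B(A) = A / B⁺A`. -/
def Quot (B : Subalgebra k A) : Type _ := A ⧸ plusMul B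

instance (B : Subalgebra k A) : AddCommGroup (Quot B) :=
  inferInstanceAs (AddCommGroup (A ⧸ plusMul B))

instance (B : Subalgebra k A) : Module k (Quot B) :=
  inferInstanceAs (Module k (A ⧸ plusMul B))

/-- The canonical projection `π_B : A → A / B⁺A`. -/
def proj (B : Subalgebra k A) : A →ₗ[k] Quot B := (plusMul B).mkQ

theorem proj_surjective (B : Subalgebra k A) : Function.Surjective (proj B) :=
  (plusMul B).mkQ_surjective

theorem proj_eq_zero (B : Subalgebra k A) (a : A) : proj B a = 0 ↔ a ∈ plusMul B :=
  Submodule.Quotient.mk_eq_zero _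

theorem proj_mul (B : Subalgebra k A) {b : A} (hb : b ∈ B) (a : A) :
    proj B (b * a) = Coalgebra.counit (R := k) b • proj B a := by
  have h : (b - algebraMap k A (Coalgebra.counit (R := k) b)) * a ∈ plusMul B := by
    refine Submodule.mul_mem_mul ⟨?_, ?_⟩ Submodule.mem_top
    · exact B.sub_mem hb (B.algebraMap_mem _)
    · simp
  have h2 : proj B ((b - algebraMap k A (Coalgebra.counit (R := k) b)) * a) = 0 := by
    rwa [proj_eq_zero]
  rw [sub_mul, map_sub, sub_eq_zero] at h2
  rw [h2, ← Algebra.smul_def, map_smul]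

theorem lTensor_proj_comul_mul (B : Subalgebra k A) [IsLeftCoidealSubalgebra B] {b : A}
    (hb : b ∈ B) (y : A ⊗[k] A) :
    (proj B).lTensor A (Coalgebra.comul b * y) = (proj B).lTensor A ((b ⊗ₜ[k] 1) * y) := by
  obtain ⟨z, hz⟩ := IsLeftCoidealSubalgebra.comul_mem b hb
  have key : ∀ z : A ⊗[k] B, (proj B).lTensor A (B.val.toLinearMap.lTensor A z * y) =
      (proj B).lTensor A ((TensorProduct.rid k A (Coalgebra.counit.lTensor A
        (B.val.toLinearMap.lTensor A z)) ⊗ₜ[k] (1 : A)) * y) := by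
    intro z
    induction z with
    | zero => simp
    | add z w h1 h2 => simp only [map_add, add_mul, h1, h2, TensorProduct.add_tmul]
    | tmul a c =>
      induction y with
      | zero => simp
      | add y w h1 h2 => simp only [map_add, mul_add, h1, h2]
      | tmul x y =>
        simp [Algebra.TensorProduct.tmul_mul_tmul, proj_mul B c.2, TensorProduct.smul_tmul']
  have h := key z
  rw [hz] at h
  simpa using h

instance plusMul_isCoideal (B : Subalgebra k A) [IsLeftCoidealSubalgebra B] :
    (plusMul B).IsCoideal where
  counit_eq_zero := by
    intro x hx
    induction hx using Submodule.mul_induction_on' with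
    | mem_mul_mem b hb a _ =>
      have : Coalgebra.counit (R := k) b = 0 := hb.2
      simp [this]
    | add x _ y _ h1 h2 => simp [h1, h2]
  map_mkQ_comul_eq_zero := by
    intro x hx
    induction hx using Submodule.mul_induction_on' with
    | mem_mul_mem b hb a _ =>
      have h1 := lTensor_proj_comul_mul B hb.1 (Coalgebra.comul a)
      rw [← Bialgebra.comul_mul] at h1
      change TensorProduct.map (proj B) (proj B) (Coalgebra.comul (b * a)) = 0
      rw [← LinearMap.rTensor_comp_lTensor, LinearMap.comp_apply, h1]
      generalize (Coalgebra.comul a : A ⊗[k] A) = y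
      induction y with
      | zero => simp
      | add y w h1 h2 => simp only [map_add, mul_add, h1, h2, add_zero]
      | tmul x y =>
        have : Coalgebra.counit (R := k) b = 0 := hb.2
        simp [Algebra.TensorProduct.tmul_mul_tmul, proj_mul B hb.1, this]
    | add x _ y _ h1 h2 => simp [h1, h2]

/-- The quotient coalgebra structure on `π_B(A)`. -/
instance (B : Subalgebra k A) [IsLeftCoidealSubalgebra B] : Coalgebra k (Quot B) :=
  inferInstanceAs (Coalgebra k (A ⧸ plusMul B))

/-- The projection `π_P : A → π_P(A)` as a coalgebra map. -/
def projHom (P : Subalgebra k A) [IsLeftCoidealSubalgebra P] : A →ₗc[k] Quot P :=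
  Coalgebra.Quotient.mkQCoalgHom (plusMul P)

theorem plusMul_mono {B P : Subalgebra k A} (h : B ≤ P) : plusMul B ≤ plusMul P :=
  mul_le_mul' (inf_le_inf_right _ h) le_rfl

theorem comul_proj (B : Subalgebra k A) [IsLeftCoidealSubalgebra B] (a : A) :
    Coalgebra.comul (R := k) (proj B a) =
      TensorProduct.map (proj B) (proj B) (Coalgebra.comul a) :=
  Coalgebra.Quotient.comul_mk (plusMul B) a

theorem counit_proj (B : Subalgebra k A) [IsLeftCoidealSubalgebra B] (a : A) :
    Coalgebra.counit (R := k) (proj B a) = Coalgebra.counit a :=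
  Coalgebra.Quotient.counit_mk (plusMul B) a

/-- The linear map `π_{B,P} : π_B(A) → π_P(A)`, `π_B(a) ↦ π_P(a)`, for `B ⊆ P`. -/
def projMap (B P : Subalgebra k A) (h : B ≤ P) : Quot B →ₗ[k] Quot P :=
  Submodule.mapQ (plusMul B) (plusMul P) LinearMap.id (plusMul_mono h)

theorem projMap_proj (B P : Subalgebra k A) (h : B ≤ P) (a : A) :
    projMap B P h (proj B a) = proj P a := rfl

/-- The map `π_{B,P}` as a coalgebra map. -/
def projBetween (B P : Subalgebra k A) [IsLeftCoidealSubalgebra B] [IsLeftCoidealSubalgebra P]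
    (h : B ≤ P) : Quot B →ₗc[k] Quot P where
  toLinearMap := projMap B P h
  counit_comp := by
    refine LinearMap.ext fun x => ?_
    obtain ⟨a, rfl⟩ := proj_surjective B x
    change Coalgebra.counit (projMap B P h (proj B a)) = Coalgebra.counit (proj B a)
    rw [projMap_proj, counit_proj, counit_proj]
  map_comp_comul := by
    refine LinearMap.ext fun x => ?_
    obtain ⟨a, rfl⟩ := proj_surjective B x
    change TensorProduct.map (projMap B P h) (projMap B P h) (Coalgebra.comul (proj B a)) =
      Coalgebra.comul (projMap B P h (proj B a))
    rw [projMap_proj, comul_proj, comul_proj]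
    generalize (Coalgebra.comul a : A ⊗[k] A) = y
    induction y with
    | zero => simp only [map_zero]
    | add x y h1 h2 => simp only [map_add, h1, h2]
    | tmul c d =>
      rw [TensorProduct.map_tmul, TensorProduct.map_tmul, TensorProduct.map_tmul, projMap_proj,
        projMap_proj]

theorem projBetween_proj (B P : Subalgebra k A) [IsLeftCoidealSubalgebra B]
    [IsLeftCoidealSubalgebra P] (h : B ≤ P) (a : A) :
    (projBetween B P h).toLinearMap (proj B a) = proj P a := rfl

theorem pushforward_coact_proj (B P : Subalgebra k A) [IsLeftCoidealSubalgebra B]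
    [IsLeftCoidealSubalgebra P] (h : B ≤ P) (a : A) :
    (LeftComodule.regular.pushforward (projBetween B P h)).coact (proj B a) =
      TensorProduct.map (proj P) (proj B) (Coalgebra.comul a) := by
  rw [LeftComodule.pushforward, LinearMap.comp_apply, LeftComodule.regular, comul_proj]
  generalize (Coalgebra.comul a : A ⊗[k] A) = y
  induction y with
  | zero => simp only [map_zero]
  | add x y h1 h2 => simp only [map_add, h1, h2]
  | tmul c d =>
    rw [TensorProduct.map_tmul, TensorProduct.map_tmul, LinearMap.rTensor_tmul, projBetween_proj]

/-- The image `π_B(P)` of `P` in `π_B(A)`. -/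
def fibre (B P : Subalgebra k A) : Submodule k (Quot B) :=
  (Subalgebra.toSubmodule P).map (proj B)

/-- The restriction `P → π_B(P)` of `π_B`. -/
def fibreProj (B P : Subalgebra k A) : P →ₗ[k] fibre B P :=
  (proj B ∘ₗ P.val.toLinearMap).codRestrict (fibre B P) (fun p => ⟨p.1, p.2, rfl⟩)

theorem subtype_fibreProj (B P : Subalgebra k A) (p : P) :
    (fibre B P).subtype (fibreProj B P p) = proj B p := rfl

/-- The left `π_P(A)`-coaction `π_B(p) ↦ π_P(p₁) ⊗ π_B(p₂)` on `π_B(P)`, for `B ⊆ P`: the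
restriction of the left coaction `(π_{B,P} ⊗ id) ∘ Δ` on `π_B(A)`. -/
def fibreComodule (B P : Subalgebra k A) [IsLeftCoidealSubalgebra B] [IsLeftCoidealSubalgebra P]
    (h : B ≤ P) : LeftComodule k (Quot P) (fibre B P) :=
  (LeftComodule.regular.pushforward (projBetween B P h)).restrict (fibre B P).subtype
    Subtype.val_injective (by
      rintro ⟨_, p, hp, rfl⟩
      obtain ⟨z, hz⟩ := IsLeftCoidealSubalgebra.comul_mem p hp
      refine ⟨TensorProduct.map (proj P) (fibreProj B P) z, ?_⟩
      rw [Submodule.subtype_apply, pushforward_coact_proj B P h p, ← hz]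
      clear hz
      induction z with
      | zero => simp only [map_zero]
      | add x y h1 h2 => simp only [map_add, h1, h2]
      | tmul c d =>
        rw [TensorProduct.map_tmul, LinearMap.lTensor_tmul, LinearMap.lTensor_tmul,
          TensorProduct.map_tmul, subtype_fibreProj]
        rfl)

end Spaces

/-- A quantum homogeneous `A`-space: a left coideal subalgebra `B ⊆ A` such that `A` is faithfully
flat as a right `B`-module and `B⁺A = AB⁺`. -/
class IsQuantumHomogeneousSpace {k : Type*} [Field k] {A : Type u} [Ring A] [HopfAlgebra k A]
    (B : Subalgebra k A) : Prop extends IsLeftCoidealSubalgebra B where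
  faithfullyFlat : RightFaithfullyFlat B
  plus_mul_comm : plus B * ⊤ = ⊤ * plus B

/-! ### Relative Hopf modules -/

section Relative

variable {k : Type*} [Field k] {A : Type*} [Ring A] [HopfAlgebra k A]

/-- The left `A`-comodule structure of a left coideal subalgebra `P ⊆ A`, given by restriction of
the coproduct. -/
def coidealComodule (P : Subalgebra k A) [IsLeftCoidealSubalgebra P] : LeftComodule k A P :=
  LeftComodule.regular.restrict P.val.toLinearMap Subtype.val_injective
    (fun p => IsLeftCoidealSubalgebra.comul_mem p.1 p.2)

/-- The restriction `Δ_L : P → A ⊗ P` of the coproduct to a left coideal subalgebra `P`. -/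
def comulL (P : Subalgebra k A) [IsLeftCoidealSubalgebra P] : P →ₗ[k] A ⊗[k] P :=
  (coidealComodule P).coact

theorem lTensor_comulL (P : Subalgebra k A) [IsLeftCoidealSubalgebra P] (p : P) :
    P.val.toLinearMap.lTensor A (comulL P p) = Coalgebra.comul (p : A) :=
  lTensor_corestrict P.val.toLinearMap Subtype.val_injective _ _ p

theorem comulL_mul (P : Subalgebra k A) [IsLeftCoidealSubalgebra P] (p q : P) :
    comulL P (p * q) = comulL P p * comulL P q := by
  have h : ∀ x y : A ⊗[k] P, P.val.toLinearMap.lTensor A (x * y) =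
      P.val.toLinearMap.lTensor A x * P.val.toLinearMap.lTensor A y :=
    fun x y => map_mul (Algebra.TensorProduct.map (AlgHom.id k A) P.val) x y
  apply lTensor_injective (X := A) P.val.toLinearMap Subtype.val_injective
  rw [h, lTensor_comulL, lTensor_comulL, lTensor_comulL, ← Bialgebra.comul_mul]
  rfl

/-- The componentwise action `(a ⊗ p) (a' ⊗ f) = a a' ⊗ p f` of `A ⊗ P` on `A ⊗ F`, for a left
`P`-module `F`. -/
def act (P : Subalgebra k A) (F : Type*) [AddCommGroup F] [Module k F] [Module P F]
    [IsScalarTower k P F] : A ⊗[k] P →ₗ[k] A ⊗[k] F →ₗ[k] A ⊗[k] F :=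
  diag A (Algebra.lsmul k k F).toLinearMap

/-- An `(A, P)`-relative Hopf module structure on a left `P`-module `F`: a left `A`-comodule
structure with `Δ_L(p f) = Δ_L(p) Δ_L(f)`. -/
structure RelativeHopfModule (P : Subalgebra k A) [IsLeftCoidealSubalgebra P]
    (F : Type*) [AddCommGroup F] [Module k F] [Module P F] [IsScalarTower k P F]
    extends LeftComodule k A F where
  coact_smul : ∀ (p : P) (f : F), coact (p • f) = act P F (comulL P p) (coact f)

/-- An isomorphism of `(A, P)`-relative Hopf modules: a bijective left `P`-module map that is also
a left `A`-comodule map. -/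
structure RelativeHopfIso {P : Subalgebra k A} [IsLeftCoidealSubalgebra P]
    {F G : Type*} [AddCommGroup F] [Module k F] [Module P F] [IsScalarTower k P F]
    [AddCommGroup G] [Module k G] [Module P G] [IsScalarTower k P G]
    (ρF : RelativeHopfModule P F) (ρG : RelativeHopfModule P G) extends F ≃ₗ[P] G where
  coact_map : ∀ f : F, ρG.coact (toLinearEquiv f) =
    (toLinearEquiv.toLinearMap.restrictScalars k).lTensor A (ρF.coact f)

/-! ### The relative Hopf module `A □_{π_P} V` -/

/-- `A` as a right `π_P(A)`-comodule, with the coaction `(id ⊗ π_P) ∘ Δ`. -/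
def rightCoaction (P : Subalgebra k A) [IsLeftCoidealSubalgebra P] :
    RightComodule k (Quot P) A :=
  RightComodule.ofCoalgHom (projHom P)

theorem rightCoaction_apply (P : Subalgebra k A) [IsLeftCoidealSubalgebra P] (a : A) :
    (rightCoaction P).coact a = (proj P).lTensor A (Coalgebra.comul a) := rfl

theorem smul_eq_tmul_mul {W : Type*} [Ring W] [Algebra k W] (a : A) (y : A ⊗[k] W) :
    a • y = (a ⊗ₜ[k] (1 : W)) * y := by
  induction y with
  | zero => simp
  | add x y h1 h2 => simp only [smul_add, mul_add, h1, h2]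
  | tmul c d => simp [Algebra.TensorProduct.tmul_mul_tmul, TensorProduct.smul_tmul']

theorem lTensor_smul {W W' : Type*} [AddCommGroup W] [Module k W] [AddCommGroup W'] [Module k W']
    (f : W →ₗ[k] W') (a : A) (y : A ⊗[k] W) : f.lTensor A (a • y) = a • f.lTensor A y := by
  induction y with
  | zero => simp
  | add x y h1 h2 => simp only [smul_add, map_add, h1, h2]
  | tmul c d => simp [TensorProduct.smul_tmul']

theorem lTensor_proj_comul_smul (P : Subalgebra k A) [IsLeftCoidealSubalgebra P] {p : A}
    (hp : p ∈ P) (a : A) : (proj P).lTensor A (Coalgebra.comul (p * a)) =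
      p • (proj P).lTensor A (Coalgebra.comul a) := by
  rw [Bialgebra.comul_mul, lTensor_proj_comul_mul P hp, ← smul_eq_tmul_mul, lTensor_smul]

theorem cotensorDiff_smul (P : Subalgebra k A) [IsLeftCoidealSubalgebra P] {V : Type*}
    [AddCommGroup V] [Module k V] (ρ : LeftComodule k (Quot P) V) {p : A} (hp : p ∈ P)
    (x : A ⊗[k] V) : cotensorDiff (rightCoaction P) ρ (p • x) =
      p • cotensorDiff (rightCoaction P) ρ x := by
  induction x with
  | zero => simp
  | add x y h1 h2 => simp only [smul_add, map_add, h1, h2]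
  | tmul a v =>
    have h : ∀ y : A ⊗[k] Quot P, TensorProduct.assoc k A (Quot P) V ((p • y) ⊗ₜ[k] v) =
        p • TensorProduct.assoc k A (Quot P) V (y ⊗ₜ[k] v) := by
      intro y
      induction y with
      | zero => simp
      | add x y h1 h2 => simp only [smul_add, map_add, TensorProduct.add_tmul, h1, h2]
      | tmul c d => simp [TensorProduct.smul_tmul']
    simp only [cotensorDiff, LinearMap.sub_apply, LinearMap.comp_apply, LinearEquiv.coe_coe,
      TensorProduct.smul_tmul', LinearMap.rTensor_tmul, LinearMap.lTensor_tmul,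
      rightCoaction_apply, smul_eq_mul, lTensor_proj_comul_smul P hp, h, smul_sub]

/-- The cotensor product `A □_{π_P} V` of `A` with a left `π_P(A)`-comodule `V`, as a left
`P`-submodule of `A ⊗ V`; here `P` acts on the first tensor factor. -/
def cotensorModule (P : Subalgebra k A) [IsLeftCoidealSubalgebra P] {V : Type*}
    [AddCommGroup V] [Module k V] (ρ : LeftComodule k (Quot P) V) : Submodule P (A ⊗[k] V) where
  __ := (cotensor (rightCoaction P) ρ).toAddSubmonoid
  smul_mem' := by
    intro p x hx
    change cotensorDiff (rightCoaction P) ρ ((p : A) • x) = 0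
    have hx' : cotensorDiff (rightCoaction P) ρ x = 0 := hx
    rw [cotensorDiff_smul P ρ p.2, hx', smul_zero]

theorem mem_cotensorModule (P : Subalgebra k A) [IsLeftCoidealSubalgebra P] {V : Type*}
    [AddCommGroup V] [Module k V] (ρ : LeftComodule k (Quot P) V) (x : A ⊗[k] V) :
    x ∈ cotensorModule P ρ ↔ x ∈ cotensor (rightCoaction P) ρ := Iff.rfl

/-- The type of elements of `A □_{π_P} V`, with its vector space and left `P`-module structures. -/
def Cotensor (P : Subalgebra k A) [IsLeftCoidealSubalgebra P] {V : Type*}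
    [AddCommGroup V] [Module k V] (ρ : LeftComodule k (Quot P) V) : Type _ :=
  cotensorModule P ρ

section

variable (P : Subalgebra k A) [IsLeftCoidealSubalgebra P] {V : Type*}
  [AddCommGroup V] [Module k V] (ρ : LeftComodule k (Quot P) V)

instance : AddCommGroup (Cotensor P ρ) := inferInstanceAs (AddCommGroup (cotensorModule P ρ))

instance : Module P (Cotensor P ρ) := inferInstanceAs (Module P (cotensorModule P ρ))

instance : Module k (Cotensor P ρ) := inferInstanceAs (Module k (cotensorModule P ρ))

instance : IsScalarTower k P (Cotensor P ρ) :=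
  inferInstanceAs (IsScalarTower k P (cotensorModule P ρ))

end

/-- The inclusion `A □_{π_P} V → A ⊗ V`. -/
def cotensorIncl (P : Subalgebra k A) [IsLeftCoidealSubalgebra P] {V : Type*}
    [AddCommGroup V] [Module k V] (ρ : LeftComodule k (Quot P) V) :
    Cotensor P ρ →ₗ[k] A ⊗[k] V :=
  (cotensorModule P ρ).subtype.restrictScalars k

theorem cotensorIncl_injective (P : Subalgebra k A) [IsLeftCoidealSubalgebra P] {V : Type*}
    [AddCommGroup V] [Module k V] (ρ : LeftComodule k (Quot P) V) :
    Function.Injective (cotensorIncl P ρ) :=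
  (cotensorModule P ρ).injective_subtype

theorem cotensorIncl_exact (P : Subalgebra k A) [IsLeftCoidealSubalgebra P] {V : Type*}
    [AddCommGroup V] [Module k V] (ρ : LeftComodule k (Quot P) V) :
    Function.Exact (cotensorIncl P ρ) (cotensorDiff (rightCoaction P) ρ) := by
  intro x
  constructor
  · intro hx
    exact ⟨⟨x, hx⟩, rfl⟩
  · rintro ⟨y, rfl⟩
    exact y.2

/-- The left `A`-comodule `A □_{π_P} V`, with the coaction `Δ ⊗ id` on the first factor. -/
def cotensorComodule (P : Subalgebra k A) [IsLeftCoidealSubalgebra P] {V : Type*}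
    [AddCommGroup V] [Module k V] (ρ : LeftComodule k (Quot P) V) :
    LeftComodule k A (Cotensor P ρ) :=
  (LeftComodule.free (C := A) V).restrict (cotensorIncl P ρ) (cotensorIncl_injective P ρ)
    (free_coact_mem (projHom P) ρ (cotensorIncl P ρ) (cotensorIncl_exact P ρ))

theorem lTensor_cotensorComodule (P : Subalgebra k A) [IsLeftCoidealSubalgebra P] {V : Type*}
    [AddCommGroup V] [Module k V] (ρ : LeftComodule k (Quot P) V) (w : Cotensor P ρ) :
    (cotensorIncl P ρ).lTensor A ((cotensorComodule P ρ).coact w) =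
      (LeftComodule.free (C := A) V).coact (cotensorIncl P ρ w) :=
  lTensor_corestrict (cotensorIncl P ρ) (cotensorIncl_injective P ρ) _ _ w

theorem free_coact_smul (P : Subalgebra k A) [IsLeftCoidealSubalgebra P] {V : Type*}
    [AddCommGroup V] [Module k V] (p : P) (t : A ⊗[k] V) :
    (LeftComodule.free (C := A) V).coact (p • t) =
      act P (A ⊗[k] V) (comulL P p) ((LeftComodule.free (C := A) V).coact t) := by
  have n3 : ∀ (z : A ⊗[k] P) (y : A ⊗[k] A) (v : V), act P (A ⊗[k] V) z
      (TensorProduct.assoc k A A V (y ⊗ₜ[k] v)) =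
      TensorProduct.assoc k A A V ((P.val.toLinearMap.lTensor A z * y) ⊗ₜ[k] v) := by
    intro z y v
    induction z with
    | zero => simp only [map_zero, LinearMap.zero_apply, zero_mul, TensorProduct.zero_tmul]
    | add x y h1 h2 => simp only [map_add, LinearMap.add_apply, add_mul,
        TensorProduct.add_tmul, h1, h2]
    | tmul a r =>
      induction y with
      | zero => simp only [map_zero, mul_zero, TensorProduct.zero_tmul]
      | add x y h1 h2 => simp only [map_add, mul_add, TensorProduct.add_tmul, h1, h2]
      | tmul b c =>
        rw [LinearMap.lTensor_tmul, Algebra.TensorProduct.tmul_mul_tmul,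
          TensorProduct.assoc_tmul, TensorProduct.assoc_tmul, act, diag_tmul]
        rfl
  induction t with
  | zero => simp only [smul_zero, map_zero]
  | add x y h1 h2 => simp only [smul_add, map_add, h1, h2]
  | tmul a v =>
    change TensorProduct.assoc k A A V (Coalgebra.comul ((p : A) * a) ⊗ₜ[k] v) =
      act P (A ⊗[k] V) (comulL P p)
        (TensorProduct.assoc k A A V (Coalgebra.comul a ⊗ₜ[k] v))
    rw [n3, lTensor_comulL, Bialgebra.comul_mul]

/-- The `(A, P)`-relative Hopf module `A □_{π_P} V`: both the left `P`-module structure and the left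
`A`-comodule structure are defined on the first tensor factor. -/
def cotensorHopf (P : Subalgebra k A) [IsLeftCoidealSubalgebra P] {V : Type*}
    [AddCommGroup V] [Module k V] (ρ : LeftComodule k (Quot P) V) :
    RelativeHopfModule P (Cotensor P ρ) where
  toLeftComodule := cotensorComodule P ρ
  coact_smul := by
    intro p f
    apply lTensor_injective (X := A) (cotensorIncl P ρ) (cotensorIncl_injective P ρ)
    have n1 := lTensor_diag (A := A) (Algebra.lsmul k k (Cotensor P ρ)).toLinearMap
      (Algebra.lsmul k k (A ⊗[k] V)).toLinearMap (LinearMap.id : P →ₗ[k] P)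
      (cotensorIncl P ρ) (cotensorIncl P ρ) (fun q w => rfl) (comulL P p)
      ((cotensorComodule P ρ).coact f)
    rw [LinearMap.lTensor_id, LinearMap.id_apply, lTensor_cotensorComodule] at n1
    refine Eq.trans ?_ n1.symm
    rw [lTensor_cotensorComodule]
    exact free_coact_smul P p _

/-! ### The relative Hopf module `P ⊗_B P` -/

/-- `B` as a subalgebra of `P`, for `B ⊆ P`. -/
def sub (B P : Subalgebra k A) : Subalgebra k P := B.comap P.val

theorem diag_mk_comulL (B P : Subalgebra k A) [IsLeftCoidealSubalgebra B]
    [IsLeftCoidealSubalgebra P] (h : B ≤ P) (x : A ⊗[k] P) (s : sub B P) (y : A ⊗[k] P) :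
    diag A (TensorOver.mk (sub B P) P) (x * comulL P s) y =
      diag A (TensorOver.mk (sub B P) P) x (comulL P s * y) := by
  obtain ⟨b, hb⟩ := s
  obtain ⟨z, hz⟩ := IsLeftCoidealSubalgebra.comul_mem (b : A) (show (b : A) ∈ B from hb)
  have e : comulL P b = (Subalgebra.inclusion h).toLinearMap.lTensor A z := by
    apply lTensor_injective (X := A) P.val.toLinearMap Subtype.val_injective
    rw [lTensor_comulL, ← hz, ← LinearMap.comp_apply, ← LinearMap.lTensor_comp]
    rfl
  rw [e, ← diag_mul, ← diag_mul]
  clear e hz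
  have n : ∀ (p : P) (c : B) (q : P),
      TensorOver.mk (sub B P) P (p * Subalgebra.inclusion h c) q =
        TensorOver.mk (sub B P) P p (Subalgebra.inclusion h c * q) := fun p c q =>
    TensorOver.balanced (sub B P) p ⟨Subalgebra.inclusion h c, c.2⟩ q
  induction z with
  | zero => simp only [map_zero, LinearMap.zero_apply]
  | add z w h1 h2 => simp only [map_add, LinearMap.add_apply, h1, h2]
  | tmul a c =>
    rw [LinearMap.lTensor_tmul]
    induction x with
    | zero => simp only [map_zero, LinearMap.zero_apply]
    | add z w h1 h2 => simp only [map_add, LinearMap.add_apply, h1, h2]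
    | tmul a' p =>
      induction y with
      | zero => simp only [map_zero]
      | add z w h1 h2 => simp only [map_add, h1, h2]
      | tmul a'' q =>
        rw [diag_tmul, diag_tmul, diag_tmul, diag_tmul, mul_assoc]
        exact congrArg _ (n p c q)

/-- The diagonal left `A`-coaction `p ⊗ q ↦ p₁ q₁ ⊗ (p₂ ⊗ q₂)` on `P ⊗_B P`. -/
def tensorCoact (B P : Subalgebra k A) [IsLeftCoidealSubalgebra B] [IsLeftCoidealSubalgebra P]
    (h : B ≤ P) : TensorOver (sub B P) P →ₗ[k] A ⊗[k] TensorOver (sub B P) P :=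
  TensorOver.lift (sub B P)
    ((diag A (TensorOver.mk (sub B P) P)).compl₁₂ (comulL P) (comulL P))
    (by
      intro r s n
      rw [LinearMap.compl₁₂_apply, LinearMap.compl₁₂_apply, comulL_mul, diag_mk_comulL B P h,
        ← comulL_mul]
      rfl)

theorem tensorCoact_tmul (B P : Subalgebra k A) [IsLeftCoidealSubalgebra B]
    [IsLeftCoidealSubalgebra P] (h : B ≤ P) (p q : P) :
    tensorCoact B P h (TensorOver.tmul (sub B P) p q) =
      diag A (TensorOver.mk (sub B P) P) (comulL P p) (comulL P q) := rfl

/-- The `(A, P)`-relative Hopf module `P ⊗_B P`: `P` acts on the first tensor factor, and the left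
`A`-coaction is the diagonal one. -/
def tensorHopf (B P : Subalgebra k A) [IsLeftCoidealSubalgebra B] [IsLeftCoidealSubalgebra P]
    (h : B ≤ P) : RelativeHopfModule P (TensorOver (sub B P) P) where
  coact := tensorCoact B P h
  coassoc := by
    intro t
    induction t using TensorOver.induction_on with
    | zero => simp only [map_zero]
    | add x y h1 h2 => simp only [map_add, h1, h2]
    | tmul p q =>
      rw [tensorCoact_tmul, assoc_comul_diag, lTensor_diag (TensorOver.mk (sub B P) P)
        (diag A (TensorOver.mk (sub B P) P)) (comulL P) (comulL P) (tensorCoact B P h)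
        (fun v w => tensorCoact_tmul B P h v w)]
      exact congrArg₂ (fun x y => diag A (diag A (TensorOver.mk (sub B P) P)) x y)
        ((coidealComodule P).coassoc p) ((coidealComodule P).coassoc q)
  counit_coact := by
    intro t
    induction t using TensorOver.induction_on with
    | zero => simp only [map_zero]
    | add x y h1 h2 => simp only [map_add, h1, h2]
    | tmul p q =>
      rw [tensorCoact_tmul, counit_diag]
      exact congrArg₂ (fun x y => TensorOver.mk (sub B P) P x y)
        ((coidealComodule P).counit_coact p) ((coidealComodule P).counit_coact q)
  coact_smul := by
    intro p t
    induction t using TensorOver.induction_on with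
    | zero => simp only [smul_zero, map_zero]
    | add x y h1 h2 => simp only [smul_add, map_add, h1, h2]
    | tmul q r =>
      rw [TensorOver.smul_tmul, tensorCoact_tmul, tensorCoact_tmul, comulL_mul, ← diag_mul, act]
      exact diag_assoc (LinearMap.mul k P) (TensorOver.mk (sub B P) P)
        (TensorOver.mk (sub B P) P) _ (fun u v w => rfl) _ _ _

/-! ### The canonical map -/

/-- The canonical map `can : A ⊗_B A → A ⊗ π_B(A)`, `a ⊗ a' ↦ a a'₁ ⊗ π_B(a'₂)`. -/
def can (B : Subalgebra k A) [IsLeftCoidealSubalgebra B] :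
    TensorOver B A →ₗ[k] A ⊗[k] Quot B :=
  TensorOver.lift B
    ((Algebra.lsmul k k (A ⊗[k] Quot B)).toLinearMap.compl₂
      ((proj B).lTensor A ∘ₗ Coalgebra.comul))
    (by
      intro a b a'
      change (a * (b : A)) • (proj B).lTensor A (Coalgebra.comul a') =
        a • (proj B).lTensor A (Coalgebra.comul ((b : A) * a'))
      rw [lTensor_proj_comul_smul B b.2, mul_smul])

/-- The map `P ⊗_B P → A ⊗_B A` induced by the inclusion `P ⊆ A`. -/
def tensorIncl (B P : Subalgebra k A) : TensorOver (sub B P) P →ₗ[k] TensorOver B A :=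
  TensorOver.lift (sub B P)
    ((TensorOver.mk B A).compl₁₂ P.val.toLinearMap P.val.toLinearMap)
    (fun r s n => TensorOver.balanced B (r : A) ⟨((s : P) : A), s.2⟩ (n : A))

/-- The inclusion `A □_{π_P} π_B(P) → A ⊗ π_B(A)`. -/
def fibreCotensorIncl (B P : Subalgebra k A) [IsLeftCoidealSubalgebra B]
    [IsLeftCoidealSubalgebra P] (h : B ≤ P) :
    Cotensor P (fibreComodule B P h) →ₗ[k] A ⊗[k] Quot B :=
  (fibre B P).subtype.lTensor A ∘ₗ cotensorIncl P (fibreComodule B P h)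

end Relative

end QHS

end

/-! The canonical map is injective because it has an explicit left inverse. The map `a ↦ S(a₁) ⊗ a₂`
from `A` to `A ⊗_B A` kills `B⁺A`, since `S(b₁)` and `b₂ ∈ B` meet across `⊗_B` to give `ε(b)`. It
therefore descends to `π_B(A)`, and extending it by multiplication on the left gives the left
inverse (`can_injective`). This works for every left coideal subalgebra, and it is applied to both
`B` and `P`.

Injectivity of `P ⊗_B P → A ⊗_B A` follows by passing through `A ⊗_B P`. Flatness over `B` handles
`A ⊗_B P → A ⊗_B A`. The map `P ⊗_B P → A ⊗_B P` is injective because, followed by `A ⊗_B P → A ⊗_P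
(P ⊗_B P)`, it becomes `x ↦ 1 ⊗ x`, which is injective by faithful flatness over `P`
(`tensorIncl_injective`). Together with `can_injective` for `B`, this makes the restricted map
injective.

That the restricted map lands in the cotensor product is coassociativity, `q₁ ⊗ π_P(q₂) ⊗ π_B(q₃)`
being read in two ways, together with stability of the cotensor product under `P`
(`fibreCoact_mem`).

Surjectivity is checked after applying `A ⊗_P -`, which reflects it. The action of `A` on the first
factor gives a map from `A ⊗_P (A □ V)` to `A ⊗ V`. On a cotensor product the two coactions agree,
so this map followed by `id ⊗ ρ` equals the flat base change of the inclusion followed by the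
canonical map of `P` tensored with `V`. Both of these are injective, hence so is the action map
(`cotensorAct_injective`). For `V = π_B(P)` every `a ⊗ π_B(p)` is the image of `a S(p₁) ⊗ (1 ⊗ p₂)`
in `A ⊗_P (P ⊗_B P)`, so the base-changed map followed by an injection is onto, and is itself onto
(`cotensorAct_map_canCotensor_surjective`). -/

noncomputable section

namespace QHS

/-! ### Consequences of faithful flatness over a noncommutative subalgebra -/

section FaithfulFlatness

variable {k : Type*} [Field k]

section

variable {R : Type*} [Ring R] [Algebra k R] (S : Subalgebra k R)
variable {N N' : Type*} [AddCommGroup N] [Module k N] [Module S N] [IsScalarTower k S N]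
  [AddCommGroup N'] [Module k N'] [Module S N'] [IsScalarTower k S N']

theorem TensorOver.map_tmul (f : N →ₗ[S] N') (r : R) (n : N) :
    TensorOver.map S f (TensorOver.tmul S r n) = TensorOver.tmul S r (f n) := rfl

theorem TensorOver.map_zero_eq : TensorOver.map S (0 : N →ₗ[S] N') = 0 := by
  refine LinearMap.ext fun x => ?_
  induction x using TensorOver.induction_on with
  | zero => simp only [map_zero]
  | add x y h1 h2 => simp only [map_add, h1, h2]
  | tmul r n =>
    rw [TensorOver.map_tmul, LinearMap.zero_apply, LinearMap.zero_apply]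
    exact map_zero (TensorOver.mk S N' r)

theorem exact_zero_left_iff {R : Type*} [Ring R] {N N' N'' : Type*} [AddCommGroup N]
    [AddCommGroup N'] [AddCommGroup N''] [Module R N] [Module R N'] [Module R N'']
    (f : N →ₗ[R] N') : Function.Exact (0 : N'' →ₗ[R] N) f ↔ Function.Injective f := by
  rw [LinearMap.exact_iff, LinearMap.range_zero, LinearMap.ker_eq_bot]

theorem exact_zero_right_iff {R : Type*} [Ring R] {N N' N'' : Type*} [AddCommGroup N]
    [AddCommGroup N'] [AddCommGroup N''] [Module R N] [Module R N'] [Module R N'']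
    (f : N →ₗ[R] N') : Function.Exact f (0 : N' →ₗ[R] N'') ↔ Function.Surjective f := by
  rw [LinearMap.exact_iff, LinearMap.ker_zero, eq_comm, LinearMap.range_eq_top]

end

variable {R : Type u} [Ring R] [Algebra k R] {S : Subalgebra k R}
variable {N N' : Type u} [AddCommGroup N] [Module k N] [Module S N] [IsScalarTower k S N]
  [AddCommGroup N'] [Module k N'] [Module S N'] [IsScalarTower k S N']

/-- Injectivity is exactness of `0 → N → N'`, and the functor sends zero maps to zero maps. -/
theorem RightFaithfullyFlat.map_injective_iff (h : RightFaithfullyFlat S) (f : N →ₗ[S] N') :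
    Function.Injective (TensorOver.map S f) ↔ Function.Injective f := by
  -- The source of the zero map is immaterial; `N` is simply an available module in the right
  -- universe.
  rw [← exact_zero_left_iff (N'' := N) f, h N N N', TensorOver.map_zero_eq, exact_zero_left_iff]

theorem RightFaithfullyFlat.map_surjective_iff (h : RightFaithfullyFlat S) (f : N →ₗ[S] N') :
    Function.Surjective (TensorOver.map S f) ↔ Function.Surjective f := by
  rw [← exact_zero_right_iff (N'' := N) f, h N N' N, TensorOver.map_zero_eq, exact_zero_right_iff]

/-- Allows the functor `R ⊗_S -` to be applied a second time, to `R ⊗_S N` with `S` acting through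
`R`. -/
instance : IsScalarTower k S (TensorOver S N) := ⟨fun c s x => by
  change ((c • (s : R)) • x) = c • ((s : R) • x)
  exact smul_assoc _ _ _⟩

/-- The unit `N → R ⊗_S N`, `n ↦ 1 ⊗ n`. -/
def TensorOver.unit (S : Subalgebra k R) (N : Type*) [AddCommGroup N] [Module k N] [Module S N] :
    N →ₗ[S] TensorOver S N where
  toFun := TensorOver.tmul S 1
  map_add' := map_add (TensorOver.mk S N 1)
  map_smul' s n := by
    rw [← TensorOver.balanced, one_mul]
    change _ = (s : R) • TensorOver.tmul S 1 n
    rw [TensorOver.smul_tmul, mul_one]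

/-- The usual descent argument: after applying `R ⊗_S -` the unit is split, and injectivity is
reflected. -/
theorem RightFaithfullyFlat.unit_injective (h : RightFaithfullyFlat S) :
    Function.Injective (TensorOver.unit S N) := by
  rw [← h.map_injective_iff]
  -- The retraction is multiplication, `r ⊗ x ↦ r x`.
  let r : TensorOver S (TensorOver S N) →ₗ[k] TensorOver S N :=
    TensorOver.lift S (Algebra.lsmul k k (TensorOver S N)).toLinearMap
      (fun r s x => mul_smul r (s : R) x)
  refine Function.LeftInverse.injective (g := r) fun x => ?_
  induction x using TensorOver.induction_on with
  | zero => simp only [map_zero]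
  | add x y h1 h2 => simp only [map_add, h1, h2]
  | tmul a n =>
    change a • TensorOver.tmul S 1 n = _
    rw [TensorOver.smul_tmul, mul_one]

end FaithfulFlatness

/-! ### Injectivity of the canonical map through the antipode -/

section Can

variable {k : Type*} [Field k] {A : Type*} [Ring A] [HopfAlgebra k A]

/-- The map `A → A ⊗_B A`, `a ↦ S(a₁) ⊗ a₂`. -/
def translation (B : Subalgebra k A) : A →ₗ[k] TensorOver B A :=
  (TensorOver.mkQ B A).restrictScalars k ∘ₗ (HopfAlgebra.antipode k).rTensor A ∘ₗ
    Coalgebra.comul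

/-- One has `S(c₁) S(b₁) ⊗ b₂ c₂ = S(c₁) S(b₁) b₂ ⊗ c₂`, as `b₂` lies in `B` and crosses the tensor
sign. For `b ∈ B⁺` the result vanishes, which is what descent to the quotient needs. -/
theorem translation_mul (B : Subalgebra k A) [IsLeftCoidealSubalgebra B] {b : A} (hb : b ∈ B)
    (c : A) : translation B (b * c) = Coalgebra.counit (R := k) b • translation B c := by
  obtain ⟨z, hz⟩ := IsLeftCoidealSubalgebra.comul_mem b hb
  have hb' := HopfAlgebra.mul_antipode_rTensor_comul_apply (R := k) b
  -- The balancing step with `Δ(b)` and `Δ(c)` replaced by arbitrary tensors `z` and `y`, so that it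
  -- can be checked on pure tensors.
  have key : ∀ (z : A ⊗[k] B) (y : A ⊗[k] A), TensorOver.mkQ B A
      ((HopfAlgebra.antipode k).rTensor A (B.val.toLinearMap.lTensor A z * y)) =
      TensorOver.mkQ B A (((LinearMap.mulRight k (LinearMap.mul' k A
        ((HopfAlgebra.antipode k).rTensor A (B.val.toLinearMap.lTensor A z))) ∘ₗ
          HopfAlgebra.antipode k).rTensor A) y) := by
    intro z y
    induction y with
    | zero => simp only [map_zero, mul_zero]
    | add x y h1 h2 => simp only [map_add, mul_add, h1, h2]
    | tmul c d =>
      induction z with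
      | zero => simp
      | add x y h1 h2 =>
        simp only [map_add, add_mul, h1, h2, LinearMap.rTensor_tmul, LinearMap.comp_apply,
          LinearMap.mulRight_apply, mul_add, TensorProduct.add_tmul]
      | tmul a b =>
        have := TensorOver.balanced B (HopfAlgebra.antipode k c * HopfAlgebra.antipode k a) b d
        simp only [LinearMap.rTensor_tmul, LinearMap.lTensor_tmul, LinearMap.comp_apply,
          LinearMap.mulRight_apply, LinearMap.mul'_apply, Algebra.TensorProduct.tmul_mul_tmul,
          HopfAlgebra.antipode_mul_antidistrib, ← mul_assoc]
        exact this.symm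
  change TensorOver.mkQ B A ((HopfAlgebra.antipode k).rTensor A (Coalgebra.comul (b * c))) = _
  rw [Bialgebra.comul_mul, ← hz, key, hz, hb']
  have e : LinearMap.mulRight k (algebraMap k A (Coalgebra.counit b)) ∘ₗ HopfAlgebra.antipode k =
      (Coalgebra.counit (R := k) b) • HopfAlgebra.antipode k (A := A) := by
    ext x
    rw [LinearMap.comp_apply, LinearMap.mulRight_apply, ← Algebra.commutes, ← Algebra.smul_def,
      LinearMap.smul_apply]
  rw [e, LinearMap.rTensor_smul, LinearMap.smul_apply]
  exact map_smul ((TensorOver.mkQ B A).restrictScalars k) _ _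

/-- The map `π_B(A) → A ⊗_B A`, `π_B(a) ↦ S(a₁) ⊗ a₂`. -/
def translationQuot (B : Subalgebra k A) [IsLeftCoidealSubalgebra B] :
    Quot B →ₗ[k] TensorOver B A :=
  (plusMul B).liftQ (translation B) (Submodule.mul_le.2 fun b hb a _ => by
    have h0 : Coalgebra.counit (R := k) b = 0 := hb.2
    rw [LinearMap.mem_ker, translation_mul B hb.1, h0, zero_smul])

theorem translationQuot_proj (B : Subalgebra k A) [IsLeftCoidealSubalgebra B] (a : A) :
    translationQuot B (proj B a) = translation B a := rfl

theorem can_tmul (B : Subalgebra k A) [IsLeftCoidealSubalgebra B] (a a' : A) :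
    can B (TensorOver.tmul B a a') = a • (proj B).lTensor A (Coalgebra.comul a') := rfl

/-- `a₁ S(a₂) ⊗ a₃ = 1 ⊗ a`. -/
theorem antipode_comul_assoc (a : A) :
    (LinearMap.mul' k A).rTensor A ((TensorProduct.assoc k A A A).symm
      (((HopfAlgebra.antipode k).rTensor A ∘ₗ Coalgebra.comul).lTensor A (Coalgebra.comul a))) =
      (1 : A) ⊗ₜ[k] a := by
  -- The antipode is moved past the rebracketing, so that coassociativity brings `(Δ ⊗ id) Δ(a)`
  -- under it and the antipode axiom applies to the first two legs.
  have h : ∀ y : A ⊗[k] (A ⊗[k] A), (LinearMap.mul' k A).rTensor A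
      ((TensorProduct.assoc k A A A).symm (((HopfAlgebra.antipode k).rTensor A).lTensor A y)) =
      (LinearMap.mul' k A ∘ₗ (HopfAlgebra.antipode k).lTensor A).rTensor A
        ((TensorProduct.assoc k A A A).symm y) := by
    intro y
    induction y with
    | zero => simp only [map_zero]
    | add x y h1 h2 => simp only [map_add, h1, h2]
    | tmul a y =>
      induction y with
      | zero => simp only [map_zero, TensorProduct.tmul_zero]
      | add x y h1 h2 => simp only [map_add, TensorProduct.tmul_add, h1, h2]
      | tmul b c => simp
  rw [LinearMap.lTensor_comp, LinearMap.comp_apply, h, Coalgebra.coassoc_symm_apply,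
    ← LinearMap.comp_apply, ← LinearMap.rTensor_comp, LinearMap.comp_assoc,
    HopfAlgebra.mul_antipode_lTensor_comul, LinearMap.rTensor_comp, LinearMap.comp_apply,
    Coalgebra.rTensor_counit_comul]
  simp

/-- The left inverse is `a ⊗ π_B(a') ↦ a S(a'₁) ⊗ a'₂`; the composite reduces to `a a'₁ S(a'₂) ⊗ a'₃
= a ⊗ a'`. -/
theorem can_injective (B : Subalgebra k A) [IsLeftCoidealSubalgebra B] :
    Function.Injective (can B) := by
  refine Function.LeftInverse.injective (g := TensorProduct.lift
    ((Algebra.lsmul k k (TensorOver B A)).toLinearMap.compl₂ (translationQuot B))) fun x => ?_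
  induction x using TensorOver.induction_on with
  | zero => simp only [map_zero]
  | add x y h1 h2 => simp only [map_add, h1, h2]
  | tmul a a' =>
    have key : ∀ y : A ⊗[k] A, TensorProduct.lift
        ((Algebra.lsmul k k (TensorOver B A)).toLinearMap.compl₂ (translationQuot B))
          (a • (proj B).lTensor A y) =
        a • TensorOver.mkQ B A ((LinearMap.mul' k A).rTensor A ((TensorProduct.assoc k A A A).symm
      (((HopfAlgebra.antipode k).rTensor A ∘ₗ Coalgebra.comul).lTensor A y))) := by
      intro y
      induction y with
      | zero => simp only [map_zero, smul_zero]
      | add x y h1 h2 => simp only [map_add, smul_add, h1, h2]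
      | tmul c d =>
        rw [LinearMap.lTensor_tmul, TensorProduct.smul_tmul', TensorProduct.lift.tmul,
          LinearMap.compl₂_apply, translationQuot_proj, translation, smul_eq_mul]
        change (a * c) • TensorOver.mkQ B A _ = _
        rw [mul_smul, ← map_smul (TensorOver.mkQ B A)]
        congr 2
        rw [LinearMap.lTensor_tmul, LinearMap.comp_apply]
        generalize (HopfAlgebra.antipode k).rTensor A (Coalgebra.comul d) = y
        induction y with
        | zero => simp
        | add x y h1 h2 => simp only [map_add, TensorProduct.tmul_add, smul_add, h1, h2]
        | tmul b c => simp [TensorProduct.smul_tmul']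
    rw [can_tmul, key, antipode_comul_assoc]
    change a • TensorOver.tmul B 1 a' = _
    rw [TensorOver.smul_tmul, mul_one]

end Can

/-! ### The action map from `A ⊗_P (A □ V)` to `A ⊗ V` -/

section Cotensor

variable {k : Type*} [Field k] {A : Type*} [Ring A] [HopfAlgebra k A]
variable (P : Subalgebra k A) (V : Type*) [AddCommGroup V] [Module k V]

/-- The map `A ⊗_P (A ⊗ V) → (A ⊗_P A) ⊗ V`. -/
def tensorOverAssoc : TensorOver P (A ⊗[k] V) →ₗ[k] TensorOver P A ⊗[k] V :=
  TensorOver.lift P (LinearMap.rTensorHom V ∘ₗ TensorOver.mk P A) (by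
    intro a p t
    induction t with
    | zero => simp only [smul_zero, map_zero]
    | add x y h1 h2 => simp only [smul_add, map_add, h1, h2]
    | tmul b v => exact congrArg (· ⊗ₜ[k] v) (TensorOver.balanced P a p b))

theorem tensorOverAssoc_tmul (a : A) (t : A ⊗[k] V) :
    tensorOverAssoc P V (TensorOver.tmul P a t) = (TensorOver.mk P A a).rTensor V t := rfl

theorem tensorOverAssoc_injective : Function.Injective (tensorOverAssoc P V) := by
  let g : TensorOver P A →ₗ[k] V →ₗ[k] TensorOver P (A ⊗[k] V) :=
    TensorOver.lift P (LinearMap.mk₂ k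
      (fun a a' => TensorOver.mk P (A ⊗[k] V) a ∘ₗ TensorProduct.mk k A V a')
      (fun a b c => by ext; simp) (fun c a b => by ext; simp)
      (fun a b c => by ext; simp) (fun c a b => by ext; simp))
      (fun a p a' => LinearMap.ext fun v => TensorOver.balanced P a p (a' ⊗ₜ[k] v))
  refine Function.LeftInverse.injective (g := TensorProduct.lift g) fun x => ?_
  induction x using TensorOver.induction_on with
  | zero => simp only [map_zero]
  | add x y h1 h2 => simp only [map_add, h1, h2]
  | tmul a t =>
    rw [tensorOverAssoc_tmul]
    change _ = TensorOver.mk P (A ⊗[k] V) a t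
    induction t with
    | zero => simp only [map_zero]
    | add x y h1 h2 => simp only [map_add, h1, h2]
    | tmul b v => rfl

variable [IsLeftCoidealSubalgebra P]

/-- The map `A ⊗_P (A ⊗ V) → A ⊗ (π_P(A) ⊗ V)`, `a ⊗ (a' ⊗ v) ↦ a a'₁ ⊗ (π_P(a'₂) ⊗ v)`. -/
def canTensor : TensorOver P (A ⊗[k] V) →ₗ[k] A ⊗[k] (Quot P ⊗[k] V) :=
  (TensorProduct.assoc k A (Quot P) V).toLinearMap ∘ₗ (can P).rTensor V ∘ₗ tensorOverAssoc P V

theorem canTensor_injective : Function.Injective (canTensor P V) :=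
  (TensorProduct.assoc k A (Quot P) V).injective.comp
    ((Module.Flat.rTensor_preserves_injective_linearMap (can P) (can_injective P)).comp
      (tensorOverAssoc_injective P V))

theorem canTensor_tmul (a : A) (t : A ⊗[k] V) :
    canTensor P V (TensorOver.tmul P a t) =
      a • TensorProduct.assoc k A (Quot P) V ((rightCoaction P).coact.rTensor V t) := by
  change TensorProduct.assoc k A (Quot P) V ((can P).rTensor V (tensorOverAssoc P V _)) = _
  rw [tensorOverAssoc_tmul]
  induction t with
  | zero => simp only [map_zero, smul_zero]
  | add x y h1 h2 => simp only [map_add, smul_add, h1, h2]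
  | tmul b v =>
    change TensorProduct.assoc k A (Quot P) V
      ((a • (rightCoaction P).coact b) ⊗ₜ[k] v) = _
    rw [LinearMap.rTensor_tmul]
    generalize (rightCoaction P).coact b = y
    induction y with
    | zero => simp only [smul_zero, map_zero, TensorProduct.zero_tmul]
    | add x y h1 h2 => simp only [smul_add, map_add, TensorProduct.add_tmul, h1, h2]
    | tmul c d => rfl

variable {V} (ρ : LeftComodule k (Quot P) V)

/-- The inclusion `A □_{π_P} V → A ⊗ V` as a map of left `P`-modules. -/
def cotensorSubtype : Cotensor P ρ →ₗ[P] A ⊗[k] V := (cotensorModule P ρ).subtype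

/-- The map `A ⊗_P (A □_{π_P} V) → A ⊗ V` given by the action of `A` on the first factor. -/
def cotensorAct : TensorOver P (Cotensor P ρ) →ₗ[k] A ⊗[k] V :=
  TensorOver.lift P
    ((Algebra.lsmul k k (A ⊗[k] V)).toLinearMap.compl₂ (cotensorIncl P ρ))
    (fun a p g => mul_smul a (p : A) (cotensorIncl P ρ g))

theorem cotensorAct_tmul (a : A) (g : Cotensor P ρ) :
    cotensorAct P ρ (TensorOver.tmul P a g) = a • cotensorIncl P ρ g := rfl

theorem cotensorAct_smul (a : A) (x : TensorOver P (Cotensor P ρ)) :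
    cotensorAct P ρ (a • x) = a • cotensorAct P ρ x := by
  induction x using TensorOver.induction_on with
  | zero => simp only [map_zero, smul_zero]
  | add x y h1 h2 => simp only [map_add, smul_add, h1, h2]
  | tmul b g => rw [TensorOver.smul_tmul, cotensorAct_tmul, cotensorAct_tmul, mul_smul]

/-- The defining equation of the cotensor product lets `id ⊗ ρ` be replaced by the right coaction of
`A`. After multiplication by `a`, the latter is the canonical map of `P` tensored with `V`. -/
theorem lTensor_cotensorAct (x : TensorOver P (Cotensor P ρ)) :
    ρ.coact.lTensor A (cotensorAct P ρ x) =
      canTensor P V (TensorOver.map P (cotensorSubtype P ρ) x) := by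
  induction x using TensorOver.induction_on with
  | zero => simp only [map_zero]
  | add x y h1 h2 => simp only [map_add, h1, h2]
  | tmul a g =>
    rw [cotensorAct_tmul, lTensor_smul]
    refine Eq.trans ?_ (canTensor_tmul P V a (cotensorIncl P ρ g)).symm
    have h : cotensorDiff (rightCoaction P) ρ (cotensorIncl P ρ g) = 0 := g.2
    rw [cotensorDiff, LinearMap.sub_apply, sub_eq_zero] at h
    rw [← h]
    rfl

end Cotensor

section CotensorFlat

variable {k : Type*} [Field k] {A : Type u} [Ring A] [HopfAlgebra k A]
variable (P : Subalgebra k A) {V : Type u} [AddCommGroup V] [Module k V]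

/-- By `lTensor_cotensorAct`, the action map followed by `id ⊗ ρ` is a composite of two injections:
the flat base change of the inclusion, and `canTensor`. -/
theorem cotensorAct_injective [IsLeftCoidealSubalgebra P] (hP : RightFaithfullyFlat P)
    (ρ : LeftComodule k (Quot P) V) : Function.Injective (cotensorAct P ρ) := by
  have h1 : Function.Injective
      (TensorOver.map P (cotensorSubtype P ρ)) :=
    (hP.map_injective_iff _).2 (cotensorIncl_injective P ρ)
  intro x y h
  apply h1
  apply canTensor_injective P V
  rw [← lTensor_cotensorAct, ← lTensor_cotensorAct, h]

end CotensorFlat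

/-! ### The map `p ↦ p₁ ⊗ π_B(p₂)` and its values in the cotensor product -/

section Fibre

variable {k : Type*} [Field k] {A : Type*} [Ring A] [HopfAlgebra k A]
variable (B P : Subalgebra k A) [IsLeftCoidealSubalgebra P]

/-- The map `P → A ⊗ π_B(P)`, `p ↦ p₁ ⊗ π_B(p₂)`. -/
def fibreCoact : P →ₗ[k] A ⊗[k] fibre B P :=
  (fibreProj B P).lTensor A ∘ₗ comulL P

theorem lTensor_subtype_fibreCoact (p : P) :
    (fibre B P).subtype.lTensor A (fibreCoact B P p) =
      (proj B).lTensor A (Coalgebra.comul (p : A)) := by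
  rw [fibreCoact, LinearMap.comp_apply, ← LinearMap.lTensor_comp_apply, ← lTensor_comulL,
    ← LinearMap.lTensor_comp_apply]
  rfl

/-- Coassociativity of the coaction on `P`: both sides are `q₁ ⊗ q₂ ⊗ π_B(q₃)`. -/
theorem lTensor_fibreCoact_comulL (q : P) :
    (fibreCoact B P).lTensor A (comulL P q) =
      (LeftComodule.free (C := A) (fibre B P)).coact (fibreCoact B P q) := by
  rw [fibreCoact, LinearMap.lTensor_comp, LinearMap.comp_apply]
  have e : TensorProduct.assoc k A A P (Coalgebra.comul.rTensor P (comulL P q)) =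
    (comulL P).lTensor A (comulL P q) := (coidealComodule P).coassoc q
  rw [← e, LinearMap.comp_apply]
  generalize comulL P q = z
  induction z with
  | zero => simp only [map_zero]
  | add x y h1 h2 => simp only [map_add, h1, h2]
  | tmul a p =>
    change _ = TensorProduct.assoc k A A _ (Coalgebra.comul a ⊗ₜ[k] fibreProj B P p)
    rw [LinearMap.rTensor_tmul]
    generalize (Coalgebra.comul a : A ⊗[k] A) = y
    induction y with
    | zero => simp only [map_zero, TensorProduct.zero_tmul]
    | add x y h1 h2 => simp only [map_add, TensorProduct.add_tmul, h1, h2]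
    | tmul c d => rfl

variable [IsLeftCoidealSubalgebra B] (h : B ≤ P)

theorem fibreComodule_coact_fibreProj (q : P) :
    (fibreComodule B P h).coact (fibreProj B P q) =
      (proj P).rTensor (fibre B P) (fibreCoact B P q) := by
  apply lTensor_injective (X := Quot P) (fibre B P).subtype Subtype.val_injective
  refine (lTensor_corestrict (fibre B P).subtype Subtype.val_injective _ _ _).trans ?_
  rw [LinearMap.comp_apply, subtype_fibreProj, pushforward_coact_proj B P h,
    ← LinearMap.rTensor_comp_lTensor, LinearMap.comp_apply, ← lTensor_subtype_fibreCoact,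
    ← LinearMap.comp_apply (LinearMap.rTensor _ _), LinearMap.rTensor_comp_lTensor,
    ← LinearMap.lTensor_comp_rTensor, LinearMap.comp_apply]

/-- Both coactions send `q₁ ⊗ π_B(q₂)` to `q₁ ⊗ π_P(q₂) ⊗ π_B(q₃)`. -/
theorem fibreCoact_mem (q : P) :
    fibreCoact B P q ∈ cotensorModule P (fibreComodule B P h) := by
  change cotensorDiff (rightCoaction P) (fibreComodule B P h) (fibreCoact B P q) = 0
  rw [cotensorDiff, LinearMap.sub_apply, sub_eq_zero]
  have e1 : (fibreComodule B P h).coact.lTensor A (fibreCoact B P q) =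
      ((proj P).rTensor (fibre B P)).lTensor A
        ((LeftComodule.free (C := A) (fibre B P)).coact (fibreCoact B P q)) := by
    have e : (fibreComodule B P h).coact ∘ₗ fibreProj B P =
        (proj P).rTensor (fibre B P) ∘ₗ fibreCoact B P :=
      LinearMap.ext (fibreComodule_coact_fibreProj B P h)
    rw [← lTensor_fibreCoact_comulL, ← LinearMap.lTensor_comp_apply, ← e,
      LinearMap.lTensor_comp_apply]
    rfl
  rw [e1]
  -- Coassociativity has been spent in `e1`; what is left holds for every tensor in `A ⊗ π_B(P)`.
  generalize fibreCoact B P q = z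
  induction z with
  | zero => simp only [map_zero]
  | add x y h1 h2 => simp only [map_add, h1, h2]
  | tmul a v =>
    change TensorProduct.assoc k A (Quot P) _
        ((proj P).lTensor A (Coalgebra.comul a) ⊗ₜ[k] v) =
      ((proj P).rTensor (fibre B P)).lTensor A
        (TensorProduct.assoc k A A _ (Coalgebra.comul a ⊗ₜ[k] v))
    generalize (Coalgebra.comul a : A ⊗[k] A) = y
    induction y with
    | zero => simp only [map_zero, TensorProduct.zero_tmul]
    | add x y h1 h2 => simp only [map_add, TensorProduct.add_tmul, h1, h2]
    | tmul c d => rfl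

/-- Since `π_B(b x) = ε(b) π_B(x)` for `b ∈ B`, only the first leg of `Δ(s)` survives. This makes
`canFibre` well defined on the balanced tensor product. -/
theorem fibreCoact_mul (s : sub B P) (q : P) :
    fibreCoact B P (s • q) = (s : P) • fibreCoact B P q := by
  apply lTensor_injective (X := A) (fibre B P).subtype Subtype.val_injective
  refine Eq.trans ?_ (lTensor_smul (fibre B P).subtype ((s : P) : A) (fibreCoact B P q)).symm
  rw [lTensor_subtype_fibreCoact, lTensor_subtype_fibreCoact]
  exact lTensor_proj_comul_smul B s.2 _

end Fibre

/-! ### Injectivity of `P ⊗_B P → A ⊗_B A` -/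

section TensorIncl

variable {k : Type*} [Field k] {A : Type*} [Ring A] [HopfAlgebra k A] {B P : Subalgebra k A}
  (h : B ≤ P)

/-- `P` as a left `B`-submodule of `A`, for `B ⊆ P`. -/
def asSubmodule : Submodule B A where
  __ := P.toSubsemiring.toAddSubmonoid
  smul_mem' b _ hp := P.mul_mem (h b.2) hp

/-- The identity map from `P` to `P` regarded as a left `B`-submodule of `A`. -/
def toAsSubmodule : P ≃ₗ[k] asSubmodule h where
  toFun p := ⟨p.1, p.2⟩
  map_add' _ _ := rfl
  map_smul' _ _ := rfl
  invFun p := ⟨p.1, p.2⟩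
  left_inv _ := rfl
  right_inv _ := rfl

/-- The map `P ⊗_B P → A ⊗_B P` induced by the inclusion `P ⊆ A`. -/
def tensorInclLeft : TensorOver (sub B P) P →ₗ[k] TensorOver B (asSubmodule h) :=
  TensorOver.lift (sub B P)
    ((TensorOver.mk B (asSubmodule h)).compl₁₂ P.val.toLinearMap (toAsSubmodule h).toLinearMap)
    (fun r s n => TensorOver.balanced B (r : A) ⟨((s : P) : A), s.2⟩ (toAsSubmodule h n))

theorem tensorInclLeft_tmul (p q : P) :
    tensorInclLeft h (TensorOver.tmul (sub B P) p q) =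
      TensorOver.tmul B (p : A) (toAsSubmodule h q) := rfl

/-- The map `A ⊗_B P → A ⊗_P (P ⊗_B P)`, `a ⊗ q ↦ a ⊗ (1 ⊗ q)`. -/
def tensorOverTensor :
    TensorOver B (asSubmodule h) →ₗ[k] TensorOver P (TensorOver (sub B P) P) :=
  TensorOver.lift B
    ((TensorOver.mk P (TensorOver (sub B P) P)).compl₂
      (TensorOver.mk (sub B P) P 1 ∘ₗ (toAsSubmodule h).symm.toLinearMap))
    (by
      intro a b p
      -- Balancing takes two moves: `b` crosses `⊗_P` as an element of `P`, then `⊗_B` inside `P ⊗_B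
      -- P`.
      have e : Subalgebra.inclusion h b • TensorOver.tmul (sub B P) (1 : P)
          ((toAsSubmodule h).symm p) =
          TensorOver.tmul (sub B P) 1 ((toAsSubmodule h).symm (b • p)) := by
        rw [TensorOver.smul_tmul, mul_one, ← one_mul (Subalgebra.inclusion h b)]
        exact TensorOver.balanced (sub B P) 1 ⟨Subalgebra.inclusion h b, b.2⟩ _
      exact (TensorOver.balanced P a (Subalgebra.inclusion h b) _).trans
        (congrArg (TensorOver.tmul P a) e))

theorem tensorOverTensor_tmul (a : A) (q : P) :
    tensorOverTensor h (TensorOver.tmul B a (toAsSubmodule h q)) =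
      TensorOver.tmul P a (TensorOver.tmul (sub B P) 1 q) := rfl

/-- In `A ⊗_P (P ⊗_B P)` one has `p ⊗ (1 ⊗ q) = 1 ⊗ (p ⊗ q)`. This identifies the composite with the
unit of the base change from `P` to `A`, whose injectivity is known. -/
theorem tensorOverTensor_tensorInclLeft (x : TensorOver (sub B P) P) :
    tensorOverTensor h (tensorInclLeft h x) = TensorOver.mk P _ 1 x := by
  induction x using TensorOver.induction_on with
  | zero => simp only [map_zero]
  | add x y h1 h2 => simp only [map_add, h1, h2]
  | tmul p q =>
    rw [tensorInclLeft_tmul, tensorOverTensor_tmul, ← one_mul (p : A), TensorOver.balanced,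
      TensorOver.smul_tmul, mul_one]
    rfl

theorem map_subtype_tensorInclLeft (x : TensorOver (sub B P) P) :
    TensorOver.map B (asSubmodule h).subtype (tensorInclLeft h x) = tensorIncl B P x := by
  induction x using TensorOver.induction_on with
  | zero => simp only [map_zero]
  | add x y h1 h2 => simp only [map_add, h1, h2]
  | tmul p q => rfl

theorem tensorIncl_injective {A : Type u} [Ring A] [HopfAlgebra k A] {B P : Subalgebra k A}
    (hB : RightFaithfullyFlat B) (hP : RightFaithfullyFlat P) (h : B ≤ P) :
    Function.Injective (tensorIncl B P) := by
  intro x y hxy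
  rw [← map_subtype_tensorInclLeft h, ← map_subtype_tensorInclLeft h] at hxy
  -- Flatness over `B` brings the equality down to `A ⊗_B P`; faithful flatness over `P` does the
  -- rest.
  have e := (hB.map_injective_iff _).2 (asSubmodule h).injective_subtype hxy
  apply hP.unit_injective
  have e' := congrArg (tensorOverTensor h) e
  rwa [tensorOverTensor_tensorInclLeft, tensorOverTensor_tensorInclLeft] at e'

end TensorIncl

/-! ### The restricted canonical map: compatibility with the structures, and surjectivity after base
change -/

section Restriction

variable {k : Type*} [Field k] {A : Type*} [Ring A] [HopfAlgebra k A]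
variable (B P : Subalgebra k A) [IsLeftCoidealSubalgebra P]

/-- `p₁ S(p₂) ⊗ π_B(p₃) = 1 ⊗ π_B(p)`. -/
theorem antipode_smul_fibreCoact (p : P) :
    TensorProduct.lift ((Algebra.lsmul k k (A ⊗[k] fibre B P)).toLinearMap.compl₂
      (fibreCoact B P)) ((HopfAlgebra.antipode k).rTensor P (comulL P p)) =
      (1 : A) ⊗ₜ[k] fibreProj B P p := by
  have e1 : ∀ y : A ⊗[k] P, TensorProduct.lift
      ((Algebra.lsmul k k (A ⊗[k] fibre B P)).toLinearMap.compl₂ (fibreCoact B P))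
        ((HopfAlgebra.antipode k).rTensor P y) =
      TensorProduct.lift ((Algebra.lsmul k k (A ⊗[k] fibre B P)).toLinearMap ∘ₗ
        HopfAlgebra.antipode k) ((fibreCoact B P).lTensor A y) := by
    intro y
    induction y with
    | zero => simp only [map_zero]
    | add x y h1 h2 => simp only [map_add, h1, h2]
    | tmul a q => rfl
  -- The antipode axiom in the form `S(a₁) a₂ ⊗ v = 1 ⊗ ε(a) v`, to be used at `p₁ ⊗ π_B(p₂)`; the
  -- counit axiom `e4` then removes `ε`.
  have e2 : ∀ z : A ⊗[k] fibre B P, TensorProduct.lift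
      ((Algebra.lsmul k k (A ⊗[k] fibre B P)).toLinearMap ∘ₗ HopfAlgebra.antipode k)
        ((LeftComodule.free (C := A) (fibre B P)).coact z) =
      (1 : A) ⊗ₜ[k] TensorProduct.lid k _ (Coalgebra.counit.rTensor (fibre B P) z) := by
    intro z
    induction z with
    | zero => simp only [map_zero, TensorProduct.tmul_zero]
    | add x y h1 h2 => simp only [map_add, TensorProduct.tmul_add, h1, h2]
    | tmul a v =>
      have e3 : ∀ y : A ⊗[k] A, TensorProduct.lift
          ((Algebra.lsmul k k (A ⊗[k] fibre B P)).toLinearMap ∘ₗ HopfAlgebra.antipode k)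
            (TensorProduct.assoc k A A _ (y ⊗ₜ[k] v)) =
          LinearMap.mul' k A ((HopfAlgebra.antipode k).rTensor A y) ⊗ₜ[k] v := by
        intro y
        induction y with
        | zero => simp only [map_zero, TensorProduct.zero_tmul]
        | add x y h1 h2 => simp only [map_add, TensorProduct.add_tmul, h1, h2]
        | tmul c d => rfl
      refine (e3 _).trans ?_
      rw [HopfAlgebra.mul_antipode_rTensor_comul_apply, Algebra.algebraMap_eq_smul_one,
        TensorProduct.smul_tmul]
      rfl
  rw [e1, lTensor_fibreCoact_comulL, e2]
  have e4 : TensorProduct.lid k P (Coalgebra.counit.rTensor P (comulL P p)) = p :=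
    (coidealComodule P).counit_coact p
  conv_rhs => rw [← e4]
  rw [fibreCoact, LinearMap.comp_apply]
  generalize comulL P p = z
  congr 1
  induction z with
  | zero => simp only [map_zero]
  | add x y h1 h2 => simp only [map_add, h1, h2]
  | tmul a q => simp

variable [IsLeftCoidealSubalgebra B] (h : B ≤ P)

/-- The map `P ⊗_B P → A ⊗ π_B(P)`, `p ⊗ q ↦ p q₁ ⊗ π_B(q₂)`. -/
def canFibre : TensorOver (sub B P) P →ₗ[k] A ⊗[k] fibre B P :=
  TensorOver.lift (sub B P)
    ((Algebra.lsmul k k (A ⊗[k] fibre B P)).toLinearMap.compl₂ (fibreCoact B P))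
    (fun p s q => by
      change (p * (s : P)) • fibreCoact B P q = p • fibreCoact B P (s • q)
      rw [fibreCoact_mul, mul_smul])

theorem canFibre_tmul (p q : P) :
    canFibre B P (TensorOver.tmul (sub B P) p q) = p • fibreCoact B P q := rfl

theorem lTensor_subtype_canFibre (x : TensorOver (sub B P) P) :
    (fibre B P).subtype.lTensor A (canFibre B P x) = can B (tensorIncl B P x) := by
  induction x using TensorOver.induction_on with
  | zero => simp only [map_zero]
  | add x y h1 h2 => simp only [map_add, h1, h2]
  | tmul p q =>
    refine (lTensor_smul (fibre B P).subtype (p : A) (fibreCoact B P q)).trans ?_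
    rw [lTensor_subtype_fibreCoact]
    rfl

/-- The restriction `P ⊗_B P → A □_{π_P} π_B(P)` of the canonical map. -/
def canCotensor : TensorOver (sub B P) P →ₗ[P] Cotensor P (fibreComodule B P h) where
  toFun x := ⟨canFibre B P x, by
    induction x using TensorOver.induction_on with
    | zero => rw [map_zero]; exact zero_mem _
    | add x y h1 h2 => rw [map_add]; exact add_mem h1 h2
    | tmul p q => exact (cotensorModule P _).smul_mem p (fibreCoact_mem B P h q)⟩
  map_add' x y := Subtype.ext (map_add (canFibre B P) x y)
  map_smul' p x := Subtype.ext (by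
    change canFibre B P (p • x) = p • canFibre B P x
    induction x using TensorOver.induction_on with
    | zero => simp only [map_zero, smul_zero]
    | add x y h1 h2 => simp only [map_add, smul_add, h1, h2]
    | tmul q r => rw [TensorOver.smul_tmul, canFibre_tmul, canFibre_tmul, mul_smul])

theorem cotensorIncl_canCotensor (x : TensorOver (sub B P) P) :
    cotensorIncl P (fibreComodule B P h) (canCotensor B P h x) = canFibre B P x := rfl

theorem fibreCotensorIncl_canCotensor (x : TensorOver (sub B P) P) :
    fibreCotensorIncl B P h (canCotensor B P h x) = can B (tensorIncl B P x) :=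
  lTensor_subtype_canFibre B P x

/-- Inside `A ⊗ (A ⊗ π_B(P))` both sides are `p₁ q₁ ⊗ p₂ q₂ ⊗ π_B(q₃)`, by multiplicativity of `Δ`
and coassociativity. -/
theorem canCotensor_coact (x : TensorOver (sub B P) P) :
    (cotensorHopf P (fibreComodule B P h)).coact (canCotensor B P h x) =
      ((canCotensor B P h).restrictScalars k).lTensor A ((tensorHopf B P h).coact x) := by
  apply lTensor_injective (X := A) _ (cotensorIncl_injective P (fibreComodule B P h))
  refine (lTensor_cotensorComodule P _ _).trans ?_
  rw [← LinearMap.lTensor_comp_apply, cotensorIncl_canCotensor]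
  change _ = (canFibre B P).lTensor A (tensorCoact B P h x)
  induction x using TensorOver.induction_on with
  | zero => simp only [map_zero]
  | add x y h1 h2 => simp only [map_add, h1, h2]
  | tmul p q =>
    rw [canFibre_tmul, free_coact_smul, tensorCoact_tmul,
      lTensor_diag (TensorOver.mk (sub B P) P)
        (Algebra.lsmul k k (A ⊗[k] fibre B P) : P →ₐ[k] _).toLinearMap LinearMap.id
        (fibreCoact B P)
        (canFibre B P) (fun v w => canFibre_tmul B P v w), LinearMap.lTensor_id,
      LinearMap.id_apply, lTensor_fibreCoact_comulL]
    rfl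

/-- The composite sends `a ⊗ (p ⊗ q)` to `a p q₁ ⊗ π_B(q₂)`. With arbitrary `a ∈ A` now allowed on
the left, the antipode can cancel `q₁`, which is impossible inside `P ⊗_B P`, as `S` need not
preserve `P`. -/
theorem cotensorAct_map_canCotensor_surjective : Function.Surjective
    (cotensorAct P (fibreComodule B P h) ∘ TensorOver.map P (canCotensor B P h)) := by
  let f : A ⊗[k] P →ₗ[k] TensorOver P (TensorOver (sub B P) P) := TensorProduct.lift
    ((TensorOver.mk P (TensorOver (sub B P) P)).compl₂ (TensorOver.mk (sub B P) P 1))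
  have hf : ∀ y : A ⊗[k] P,
      cotensorAct P (fibreComodule B P h) (TensorOver.map P (canCotensor B P h) (f y)) =
      TensorProduct.lift ((Algebra.lsmul k k (A ⊗[k] fibre B P)).toLinearMap.compl₂
        (fibreCoact B P)) y := by
    intro y
    induction y with
    | zero => simp only [map_zero]
    | add x y h1 h2 => simp only [map_add, h1, h2]
    | tmul a q =>
      change a • ((1 : P) • fibreCoact B P q) = a • fibreCoact B P q
      rw [one_smul]
  intro t
  induction t with
  | zero => exact ⟨0, by simp only [Function.comp_apply, map_zero]⟩
  | add x y h1 h2 =>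
    obtain ⟨x', rfl⟩ := h1
    obtain ⟨y', rfl⟩ := h2
    exact ⟨x' + y', by simp only [Function.comp_apply, map_add]⟩
  | tmul a v =>
    obtain ⟨_, p, hp, rfl⟩ := v
    -- The preimage `a S(p₁) ⊗ (1 ⊗ p₂)` maps to `a S(p₁) p₂ ⊗ π_B(p₃) = a ⊗ π_B(p)`.
    refine ⟨a • f ((HopfAlgebra.antipode k).rTensor P (comulL P ⟨p, hp⟩)), ?_⟩
    rw [Function.comp_apply, map_smul, cotensorAct_smul, hf, antipode_smul_fibreCoact,
      TensorProduct.smul_tmul', smul_eq_mul, mul_one]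
    rfl

end Restriction

/-! ### Bijectivity of the restricted canonical map -/

section Main

variable {k : Type*} [Field k] {A : Type u} [Ring A] [HopfAlgebra k A]
variable (B P : Subalgebra k A) [IsQuantumHomogeneousSpace B] [IsQuantumHomogeneousSpace P]
  (h : B ≤ P)

/-- Viewed in `A ⊗ π_B(A)`, the map is a composite of the two injections `tensorIncl` and `can`. -/
theorem canCotensor_injective : Function.Injective (canCotensor B P h) := by
  intro x y hxy
  apply tensorIncl_injective IsQuantumHomogeneousSpace.faithfullyFlat
    IsQuantumHomogeneousSpace.faithfullyFlat h
  apply can_injective B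
  rw [← fibreCotensorIncl_canCotensor B P h, hxy, fibreCotensorIncl_canCotensor]

/-- Faithful flatness over `P` reduces the claim to the base change along `P ⊆ A`. There, `u ∘ v`
surjective and `u` injective make `v` surjective, with `u` the action map. -/
theorem canCotensor_surjective : Function.Surjective (canCotensor B P h) := by
  have hP : RightFaithfullyFlat P := IsQuantumHomogeneousSpace.faithfullyFlat
  rw [← hP.map_surjective_iff]
  intro g
  obtain ⟨x, hx⟩ := cotensorAct_map_canCotensor_surjective B P h
    (cotensorAct P (fibreComodule B P h) g)
  exact ⟨x, cotensorAct_injective P hP _ hx⟩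

/-- The canonical map restricts to an isomorphism `P ⊗_B P ≃ A □_{π_P} π_B(P)` of
`(A, P)`-relative Hopf modules. -/
def canIso : RelativeHopfIso (tensorHopf B P h) (cotensorHopf P (fibreComodule B P h)) where
  __ := LinearEquiv.ofBijective (canCotensor B P h)
    ⟨canCotensor_injective B P h, canCotensor_surjective B P h⟩
  coact_map := canCotensor_coact B P h

end Main

end QHS

end

theorem mainTheorem4 {A : Type u} [Ring A] [HopfAlgebra ℂ A]
    (hS : Function.Bijective (HopfAlgebra.antipode ℂ (A := A)))
    (B P : Subalgebra ℂ A) [QHS.IsQuantumHomogeneousSpace B] [QHS.IsQuantumHomogeneousSpace P]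
    (hBP : B ≤ P) :
    Function.Injective (QHS.tensorIncl B P) ∧
      ∃ e : QHS.RelativeHopfIso (QHS.tensorHopf B P hBP)
          (QHS.cotensorHopf P (QHS.fibreComodule B P hBP)),
        ∀ x : QHS.TensorOver (QHS.sub B P) P,
          QHS.fibreCotensorIncl B P hBP (e.toLinearEquiv x) =
            QHS.can B (QHS.tensorIncl B P x) :=
  ⟨QHS.tensorIncl_injective QHS.IsQuantumHomogeneousSpace.faithfullyFlat
      QHS.IsQuantumHomogeneousSpace.faithfullyFlat hBP,
    QHS.canIso B P hBP, QHS.fibreCotensorIncl_canCotensor B P hBP⟩
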